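/- Let $U\subset\mathbb{C}^n$ be an open neighbourhood of $0$ (for instance $U=\mathbb{C}^n$) and let $F:U\to\mathbb{C}^n$ be a holomorphic map with $F(0)=0$ whose derivative $L=F'(0)$ is invertible and contracting, i.e. all eigenvalues of $L$ are non-zero and of modulus $<1$. Let $\lambda_1,\dots,\lambda_l$ be the distinct eigenvalues of $L$ and $E_{\lambda_1},\dots,E_{\lambda_l}$ its generalized eigenspaces, so that $\mathbb{C}^n=E_{\lambda_1}\oplus\cdots\oplus E_{\lambda_l}$. A homogeneous polynomial map $Q:\mathbb{C}^n\to\mathbb{C}^n$ with $Q(0)=0$ is said to be of type $s=(s_1,\dots,s_l)\in\mathbb{N}^l$ if \[ Q(a_1t_1+\cdots+a_lt_l)=a_1^{s_1}\cdots a_l^{s_l}\,Q(t_1+\cdots+t_l) \] for all $a_1,\dots,a_l\in\mathbb{C}$ and all $(t_1,\dots,t_l)\in E_{\lambda_1}\times\cdots\times E_{\lambda_l}$. A polynomial map $P:\mathbb{C}^n\to\mathbb{C}^n$ with $P(0)=0$ is sub-resonant with respect to $L$ if, for each $i$, its component $P_i:\mathbb{C}^n\to E_{\lambda_i}$ is a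 finite sum of homogeneous polynomial maps $\mathbb{C}^n\to E_{\lambda_i}$ of types $s$ satisfying $\ln|\lambda_i|\le\sum_j s_j\ln|\lambda_j|$. Let $SR^*(L)$ be the set of sub-resonant polynomial maps whose derivative at $0$ is invertible. Then there exist $P\in SR^*(L)$ with $P'(0)=L$ and a biholomorphism $\phi$ between two open neighbourhoods of $0$ in $\mathbb{C}^n$, with $\phi(0)=0$ and $\phi'(0)=\mathrm{Id}$, such that $\phi^{-1}\circ F\circ\phi=P$ on a neighbourhood of $0$. -/

import Mathlib

open scoped Topology

noncomputable section

namespace SubResonance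

variable {n : ℕ}

/-- A polynomial map `ℂⁿ → ℂⁿ`: every coordinate is given by a polynomial. -/
def IsPolynomialMap (P : (Fin n → ℂ) → (Fin n → ℂ)) : Prop :=
  ∃ p : Fin n → MvPolynomial (Fin n) ℂ, ∀ x i, P x i = MvPolynomial.eval x (p i)

/-- A homogeneous polynomial map `ℂⁿ → ℂⁿ` of degree `d`. -/
def IsHomogeneousPolynomialMap (d : ℕ) (Q : (Fin n → ℂ) → (Fin n → ℂ)) : Prop :=
  ∃ q : Fin n → MvPolynomial (Fin n) ℂ,
    (∀ i, (q i).IsHomogeneous d) ∧ ∀ x i, Q x i = MvPolynomial.eval x (q i)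

/-- `Q` is a homogeneous polynomial map fixing `0`, of type `s` with respect to the decomposition
of `ℂⁿ` into the generalized eigenspaces of `L`. Types are indexed by the distinct eigenvalues. -/
structure IsHomogeneousOfType (L : Module.End ℂ (Fin n → ℂ)) (s : L.Eigenvalues → ℕ)
    (Q : (Fin n → ℂ) → (Fin n → ℂ)) : Prop where
  homogeneous : ∃ d, IsHomogeneousPolynomialMap d Q
  map_zero : Q 0 = 0
  scaling : ∀ (a : L.Eigenvalues → ℂ) (t : L.Eigenvalues → (Fin n → ℂ)),
    (∀ μ : L.Eigenvalues, t μ ∈ L.maxGenEigenspace (μ : ℂ)) →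
      Q (∑ μ, a μ • t μ) = (∏ μ, a μ ^ s μ) • Q (∑ μ, t μ)

/-- The sub-resonance relation for a term of type `s` with values in the generalized eigenspace
of the eigenvalue `μ`. -/
def SubResonanceRelation (L : Module.End ℂ (Fin n → ℂ)) (μ : L.Eigenvalues)
    (s : L.Eigenvalues → ℕ) : Prop :=
  Real.log ‖(μ : ℂ)‖ ≤ ∑ ν : L.Eigenvalues, (s ν : ℝ) * Real.log ‖(ν : ℂ)‖

/-- `R` is a map into the generalized eigenspace of `μ` which is a finite sum of homogeneous
terms whose types satisfy the sub-resonance relation. -/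
def IsSubResonantComponent (L : Module.End ℂ (Fin n → ℂ)) (μ : L.Eigenvalues)
    (R : (Fin n → ℂ) → (Fin n → ℂ)) : Prop :=
  ∃ (T : Finset (L.Eigenvalues → ℕ)) (Q : (L.Eigenvalues → ℕ) → (Fin n → ℂ) → (Fin n → ℂ)),
    (∀ s ∈ T, SubResonanceRelation L μ s ∧ IsHomogeneousOfType L s (Q s) ∧
      ∀ x, Q s x ∈ L.maxGenEigenspace (μ : ℂ)) ∧
    ∀ x, R x = ∑ s ∈ T, Q s x

/-- Polynomial maps fixing `0` of sub-resonance type with respect to `L`: in the (unique)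
decomposition of `P` into components with values in the generalized eigenspaces of `L`, every
component consists of sub-resonant terms only. -/
def IsSubResonant (L : Module.End ℂ (Fin n → ℂ)) (P : (Fin n → ℂ) → (Fin n → ℂ)) : Prop :=
  IsPolynomialMap P ∧ P 0 = 0 ∧
    ∃ R : L.Eigenvalues → (Fin n → ℂ) → (Fin n → ℂ),
      (∀ μ, IsSubResonantComponent L μ (R μ)) ∧ ∀ x, P x = ∑ μ, R μ x

/-- `SR*(L)`: the sub-resonance type polynomial maps whose derivative at `0` is invertible. -/
def SRStar (L : Module.End ℂ (Fin n → ℂ)) : Set ((Fin n → ℂ) → (Fin n → ℂ)) :=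
  {P | IsSubResonant L P ∧ (fderiv ℂ P 0).IsInvertible}

/-- A linear map is contracting if all its eigenvalues have modulus less than one. -/
def IsContracting (L : Module.End ℂ (Fin n → ℂ)) : Prop :=
  ∀ μ : ℂ, L.HasEigenvalue μ → ‖μ‖ < 1

/-- A local biholomorphism of `ℂⁿ`: a homeomorphism between two open sets which is holomorphic
and has holomorphic inverse. -/
def IsLocalBiholomorphism (φ : OpenPartialHomeomorph (Fin n → ℂ) (Fin n → ℂ)) : Prop :=
  DifferentiableOn ℂ φ φ.source ∧ DifferentiableOn ℂ φ.symm φ.target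

end SubResonance

end

/-
By Taylor expansion `F` is conjugate, up to terms of order `d`, to a sub-resonant polynomial map,
inductively in `d`: a change of variables `z - H z` with `H` homogeneous of degree `d` alters the
terms of degree `d` by `L ∘ H - H ∘ L`, and every homogeneous `M` differs from such a map by a
sub-resonant one. Indeed, on the block of `M` going from `E_ν₁ × ⋯ × E_νd` to `E_μ`, the operator
`M ↦ L⁻¹ ∘ M ∘ (L, …, L)` has spectral radius `|ν₁ ⋯ νd| / |μ|`, which is less than `1` exactly when
the block is not sub-resonant, and then a geometric series solves the equation.

Let `G` be a local inverse of `F` with Lipschitz constant `Λ`, and let `P` contract an adapted norm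
by `θ < 1`. If `φ` conjugates `F` to `P` up to order `K` and `Λ θᴷ < 1`, then `G ∘ φ ∘ P - φ` is of
order `K` and the maps `Gᵏ ∘ φ ∘ Pᵏ` converge geometrically to an exact conjugacy.
-/

noncomputable section

namespace SubResonance

open Metric Set Filter Asymptotics

section Holomorphic

variable {E F G : Type*} [NormedAddCommGroup E] [NormedSpace ℂ E] [NormedAddCommGroup F]
  [NormedSpace ℂ F] [NormedAddCommGroup G] [NormedSpace ℂ G]

/-- `f` is holomorphic at `x`: complex differentiable on a neighbourhood of `x`. -/
def HolomorphicAt (f : E → F) (x : E) : Prop :=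
  ∀ᶠ z in 𝓝 x, DifferentiableAt ℂ f z

namespace HolomorphicAt

variable {f g : E → F} {x : E}

theorem differentiableAt (hf : HolomorphicAt f x) : DifferentiableAt ℂ f x :=
  hf.self_of_nhds

theorem sub (hf : HolomorphicAt f x) (hg : HolomorphicAt g x) :
    HolomorphicAt (fun z => f z - g z) x := by
  filter_upwards [hf, hg] with z hfz hgz using hfz.fun_sub hgz

theorem comp {u : F → G} (hu : HolomorphicAt u (f x)) (hf : HolomorphicAt f x) :
    HolomorphicAt (fun z => u (f z)) x := by
  filter_upwards [hf, hf.differentiableAt.continuousAt.eventually hu] with z hfz huz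
  exact huz.comp z hfz

end HolomorphicAt

theorem norm_fderiv_le_of_forall_mem_ball {f : E → F} {c : E} {R M : ℝ} (hR : 0 < R)
    (hd : DifferentiableOn ℂ f (ball c R)) (hM : ∀ z ∈ ball c R, ‖f z‖ ≤ M) :
    ‖fderiv ℂ f c‖ ≤ 2 * M / R := by
  refine Complex.norm_fderiv_le_div_of_mapsTo_ball hd (fun z hz => ?_) hR
  rw [mem_closedBall, dist_eq_norm]
  linarith [norm_sub_le (f z) (f c), hM z hz, hM c (mem_ball_self hR)]

theorem norm_sub_sub_fderiv_le {f : E → F} {c w : E} {R M : ℝ} (hR : 0 < R)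
    (hd : DifferentiableOn ℂ f (ball c R)) (hM : ∀ z ∈ ball c R, ‖f z‖ ≤ M) (hw : ‖w‖ < R) :
    ‖f (c + w) - f c - fderiv ℂ f c w‖ ≤ 4 * M * (‖w‖ / R) ^ 2 := by
  have hc : DifferentiableAt ℂ f c := hd.differentiableAt (ball_mem_nhds c hR)
  have hlin : ∀ z ∈ ball c R, ‖fderiv ℂ f c (z - c)‖ ≤ 2 * M := fun z hz => by
    calc ‖fderiv ℂ f c (z - c)‖ ≤ ‖fderiv ℂ f c‖ * ‖z - c‖ := (fderiv ℂ f c).le_opNorm _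
      _ ≤ 2 * M / R * R := by
        have := norm_fderiv_le_of_forall_mem_ball hR hd hM
        gcongr
        · exact (norm_nonneg _).trans this
        · exact (mem_ball_iff_norm.1 hz).le
      _ = 2 * M := div_mul_cancel₀ _ hR.ne'
  have key := Complex.dist_le_mul_div_pow_of_mapsTo_ball_of_isLittleO (n := 1)
    (f := fun z => f z - f c - fderiv ℂ f c (z - c)) (c := c) (z := c + w) (R₁ := R) (R₂ := 4 * M)
    ((hd.sub_const _).sub (by fun_prop)) (fun z hz => ?_) ?_ (by simpa [dist_eq_norm] using hw)
  · simpa [dist_eq_norm] using key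
  · rw [mem_closedBall, dist_eq_norm]
    simp only [sub_self, map_zero, sub_zero]
    linarith [norm_sub_le (f z - f c) (fderiv ℂ f c (z - c)), norm_sub_le (f z) (f c), hlin z hz,
      hM z hz, hM c (mem_ball_self hR)]
  · simpa using hc.hasFDerivAt.isLittleO.norm_right

theorem uniformCauchySeqOn_fderiv {ι : Type*} {l : Filter ι} {f : ι → E → F} {s t : Set E} {r : ℝ}
    (hr : 0 < r) (hst : ∀ y ∈ t, ball y r ⊆ s) (hf : ∀ᶠ k in l, DifferentiableOn ℂ (f k) s)
    (h : UniformCauchySeqOn f l s) :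
    UniformCauchySeqOn (fun k => fderiv ℂ (f k)) l t := by
  intro u hu
  obtain ⟨ε, hε, hεu⟩ := mem_uniformity_dist.1 hu
  have hclose := h _ (dist_mem_uniformity (show 0 < ε * r / 4 by positivity))
  filter_upwards [hclose, hf.prod_mk hf] with k hk hd y hy
  have hdiff : ∀ j, DifferentiableOn ℂ (f j) s → DifferentiableAt ℂ (f j) y := fun j hj =>
    (hj.mono (hst y hy)).differentiableAt (ball_mem_nhds y hr)
  refine hεu ?_
  rw [dist_eq_norm, ← fderiv_sub (hdiff _ hd.1) (hdiff _ hd.2)]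
  have hle := norm_fderiv_le_of_forall_mem_ball (M := ε * r / 4) hr
    ((hd.1.sub hd.2).mono (hst y hy)) fun z hz => by
      exact (dist_eq_norm (f k.1 z) (f k.2 z) ▸ hk z (hst y hy hz) :).le
  refine hle.trans_lt ?_
  field_simp
  linarith

theorem ball_subset_ball_two_mul {X : Type*} [PseudoMetricSpace X] {x y : X} {R : ℝ}
    (hy : y ∈ ball x R) :
    ball y R ⊆ ball x (2 * R) :=
  ball_subset_ball' (by linarith [mem_ball.1 hy])

theorem differentiableOn_of_tendstoUniformlyOn [CompleteSpace F] {ι : Type*} {l : Filter ι}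
    [NeBot l] {f : ι → E → F} {g : E → F} {s : Set E} (hs : IsOpen s)
    (hf : ∀ᶠ k in l, DifferentiableOn ℂ (f k) s) (h : TendstoUniformlyOn f g l s) :
    DifferentiableOn ℂ g s := by
  intro x hx
  obtain ⟨r, hr, hrs⟩ : ∃ r > 0, ball x (2 * r) ⊆ s := by
    obtain ⟨ε, hε, h⟩ := Metric.isOpen_iff.1 hs x hx
    exact ⟨ε / 2, by positivity, by rwa [mul_div_cancel₀ _ two_ne_zero]⟩
  have hC : UniformCauchySeqOn (fun k => fderiv ℂ (f k)) l (ball x r) :=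
    uniformCauchySeqOn_fderiv hr (fun y hy => (ball_subset_ball_two_mul hy).trans hrs) hf
      h.uniformCauchySeqOn
  have hlim : ∀ y ∈ ball x r, ∃ A, Tendsto (fun k => fderiv ℂ (f k) y) l (𝓝 A) := fun y hy =>
    CompleteSpace.complete (hC.cauchy_map hy)
  choose! g' hg' using hlim
  have hf' : TendstoUniformlyOnFilter (fun k => fderiv ℂ (f k)) g' l (𝓝 x) :=
    (tendstoUniformlyOn_iff_tendstoUniformlyOnFilter.1
      (hC.tendstoUniformlyOn_of_tendsto hg')).mono_right (le_principal_iff.2 (ball_mem_nhds x hr))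
  refine (hasFDerivAt_of_tendstoUniformlyOnFilter (𝕜 := ℂ) (f := f) hf' ?_
    ?_).differentiableAt.differentiableWithinAt
  · filter_upwards [hf.prod_mk (hs.mem_nhds hx)] with p hp
    exact (hp.1.differentiableAt (hs.mem_nhds hp.2)).hasFDerivAt
  · filter_upwards [hs.mem_nhds hx] with y hy using h.tendsto_at hy

theorem eventually_norm_smul_lt (v : E) {R : ℝ} (hR : 0 < R) :
    ∀ᶠ h : ℂ in 𝓝[≠] 0, ‖h • v‖ < R := by
  have : ∀ᶠ h : ℂ in 𝓝 0, ‖h • v‖ < R :=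
    ContinuousAt.eventually_lt (by fun_prop) continuousAt_const (by simpa using hR)
  exact nhdsWithin_le_nhds this

theorem tendstoUniformlyOn_difference_quotient {f : E → F} {x : E} {R M : ℝ} (hR : 0 < R)
    (hd : DifferentiableOn ℂ f (ball x (2 * R))) (hM : ∀ z ∈ ball x (2 * R), ‖f z‖ ≤ M) (v : E) :
    TendstoUniformlyOn (fun (h : ℂ) y => h⁻¹ • (f (y + h • v) - f y)) (fun y => fderiv ℂ f y v)
      (𝓝[≠] 0) (ball x R) := by
  rw [Metric.tendstoUniformlyOn_iff]
  intro ε hε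
  have hsmall : ∀ᶠ h : ℂ in 𝓝 0, ‖h‖ * (4 * M * (‖v‖ / R) ^ 2) < ε :=
    ContinuousAt.eventually_lt (by fun_prop) continuousAt_const (by simpa using hε)
  filter_upwards [eventually_norm_smul_lt v hR, nhdsWithin_le_nhds hsmall,
    self_mem_nhdsWithin] with h hhv hhε (h0 : h ≠ 0) y hy
  have hsub := ball_subset_ball_two_mul hy
  have hquot : h⁻¹ • (f (y + h • v) - f y) - fderiv ℂ f y v =
      h⁻¹ • (f (y + h • v) - f y - fderiv ℂ f y (h • v)) := by
    rw [smul_sub h⁻¹ (f (y + h • v) - f y), map_smul, inv_smul_smul₀ h0]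
  rw [dist_eq_norm, norm_sub_rev, hquot, norm_smul, norm_inv]
  have : 0 < ‖h‖ := norm_pos_iff.2 h0
  calc ‖h‖⁻¹ * ‖f (y + h • v) - f y - fderiv ℂ f y (h • v)‖
      ≤ ‖h‖⁻¹ * (4 * M * (‖h • v‖ / R) ^ 2) := by
        gcongr
        exact norm_sub_sub_fderiv_le hR (hd.mono hsub) (fun z hz => hM z (hsub hz)) hhv
    _ = ‖h‖ * (4 * M * (‖v‖ / R) ^ 2) := by rw [norm_smul]; field_simp
    _ < ε := hhε

theorem differentiableOn_clm_apply [FiniteDimensional ℂ E] {f : G → E →L[ℂ] F} {s : Set G} :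
    DifferentiableOn ℂ f s ↔ ∀ y, DifferentiableOn ℂ (fun x => f x y) s := by
  refine ⟨fun h y => h.clm_apply (differentiableOn_const y), fun h => ?_⟩
  let e : (E →L[ℂ] F) ≃L[ℂ] Fin (Module.finrank ℂ E) → F :=
    ((ContinuousLinearEquiv.ofFinrankEq (Module.finrank_fin_fun ℂ).symm).arrowCongr
      (1 : F ≃L[ℂ] F)).trans (ContinuousLinearEquiv.piRing _)
  rw [← e.comp_differentiableOn_iff]
  exact differentiableOn_pi.2 fun i => h _

namespace HolomorphicAt

variable {f : E → F} {x : E}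

theorem exists_ball_bounded (hf : HolomorphicAt f x) :
    ∃ R > 0, ∃ M, DifferentiableOn ℂ f (ball x R) ∧ ∀ z ∈ ball x R, ‖f z‖ ≤ M := by
  have hbdd : ∀ᶠ z in 𝓝 x, ‖f z‖ < ‖f x‖ + 1 :=
    hf.differentiableAt.continuousAt.norm.eventually_lt continuousAt_const (by simp)
  obtain ⟨R, hR, h⟩ := eventually_nhds_iff_ball.1 (hf.and hbdd)
  exact ⟨R, hR, _, fun z hz => (h z hz).1.differentiableWithinAt, fun z hz => (h z hz).2.le⟩

variable [FiniteDimensional ℂ E] [CompleteSpace F]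

/- Directional derivatives are uniform limits of the holomorphic difference quotients. -/
theorem fderiv (hf : HolomorphicAt f x) : HolomorphicAt (fderiv ℂ f) x := by
  obtain ⟨R', hR', M, hd, hM⟩ := hf.exists_ball_bounded
  obtain ⟨R, rfl⟩ : ∃ R, R' = 2 * R := ⟨R' / 2, by ring⟩
  have hR : 0 < R := by linarith
  have hdiff : DifferentiableOn ℂ (_root_.fderiv ℂ f) (ball x R) := by
    refine differentiableOn_clm_apply.2 fun v => differentiableOn_of_tendstoUniformlyOn isOpen_ball
      ?_ (tendstoUniformlyOn_difference_quotient hR hd hM v)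
    filter_upwards [eventually_norm_smul_lt v hR] with h hh
    refine .const_smul (.sub ?_ (hd.mono (ball_subset_ball (by linarith)))) _
    exact hd.comp (by fun_prop) fun y hy =>
      ball_subset_ball_two_mul hy (by simpa [dist_eq_norm] using hh)
  filter_upwards [ball_mem_nhds x hR] with z hz
  exact hdiff.differentiableAt (isOpen_ball.mem_nhds hz)

theorem contDiffAt_one (hf : HolomorphicAt f x) : ContDiffAt ℂ 1 f x := by
  refine contDiffAt_one_iff.2 ⟨_root_.fderiv ℂ f, _, hf.and hf.fderiv, fun z hz => ?_, ?_⟩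
  · exact hz.2.continuousAt.continuousWithinAt
  · exact fun z hz => hz.1.hasFDerivAt

end HolomorphicAt

end Holomorphic

section Taylor

universe u

variable {E F : Type u} [NormedAddCommGroup E] [NormedSpace ℂ E] [NormedAddCommGroup F]
  [NormedSpace ℂ F]

theorem HolomorphicAt.isBigO_fderiv {f : E → F} {d : ℕ} (hf : HolomorphicAt f 0)
    (hd : f =O[𝓝 0] fun z => ‖z‖ ^ (d + 1)) :
    _root_.fderiv ℂ f =O[𝓝 0] fun z => ‖z‖ ^ d := by
  rw [← pure_sup_nhdsNE, isBigO_sup]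
  constructor
  · refine isBigO_pure.2 fun hz => ?_
    have hd0 : d ≠ 0 := by rintro rfl; simp at hz
    exact (IsBigO.hasFDerivAt (n := d + 1) (by simpa using hd) (by omega)).fderiv
  obtain ⟨C, hC, hb⟩ := hd.exists_pos
  obtain ⟨R, hR, h⟩ := eventually_nhds_iff_ball.1 (hf.and hb.bound)
  refine IsBigO.of_bound (2 ^ (d + 2) * C) ?_
  filter_upwards [nhdsWithin_le_nhds (ball_mem_nhds (0 : E) (half_pos hR)), self_mem_nhdsWithin]
    with z hz (hz0 : z ≠ 0)
  have hzpos : 0 < ‖z‖ := norm_pos_iff.2 hz0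
  rw [mem_ball_zero_iff] at hz
  have hsub : ∀ w ∈ ball z ‖z‖, ‖w‖ ≤ 2 * ‖z‖ := fun w hw => by
    linarith [norm_le_norm_sub_add w z, mem_ball_iff_norm.1 hw]
  have hsub' : ∀ w ∈ ball z ‖z‖, w ∈ ball 0 R := fun w hw => by
    rw [mem_ball_zero_iff]
    linarith [hsub w hw]
  have hle := norm_fderiv_le_of_forall_mem_ball (M := C * (2 * ‖z‖) ^ (d + 1)) hzpos
    (fun w hw => (h w (hsub' w hw)).1.differentiableWithinAt) fun w hw => by
      refine (h w (hsub' w hw)).2.trans ?_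
      rw [norm_pow, norm_norm]
      gcongr
      exact hsub w hw
  rw [norm_pow, norm_norm]
  refine hle.trans_eq ?_
  field_simp
  ring

theorem hasDerivAt_smul_sub_pow_smul {f : E → F} {d : ℕ}
    (N : ContinuousMultilinearMap ℂ (fun _ : Fin d => E) (E →L[ℂ] F)) {t : ℂ} {z : E}
    (hf : DifferentiableAt ℂ f (t • z)) :
    HasDerivAt (fun t : ℂ => f (t • z) - (t ^ (d + 1) * ((d : ℂ) + 1)⁻¹) • N (fun _ => z) z)
      ((_root_.fderiv ℂ f (t • z) - N fun _ => t • z) z) t := by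
  have hd0 : (d : ℂ) + 1 ≠ 0 := by exact_mod_cast d.succ_ne_zero
  have hN : (N fun _ => t • z) = t ^ d • N fun _ => z := by
    simpa using N.map_smul_univ (fun _ => t) (fun _ => z)
  have hsmul : HasDerivAt (fun t : ℂ => t • z) z t := by
    simpa using (hasDerivAt_id t).smul_const z
  have hpow : HasDerivAt (fun t : ℂ => t ^ (d + 1) * ((d : ℂ) + 1)⁻¹) (t ^ d) t := by
    refine ((hasDerivAt_pow (d + 1) t).mul_const ((d : ℂ) + 1)⁻¹).congr_deriv ?_
    push_cast
    field_simp
  rw [hN]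
  exact (hf.hasFDerivAt.comp_hasDerivAt t hsmul).sub (hpow.smul_const (N (fun _ => z) z))

/- Integrate the radial derivative of `f` along the segment from `0` to `z`. -/
theorem HolomorphicAt.isBigO_sub_of_fderiv {f : E → F} {d k : ℕ} (hf : HolomorphicAt f 0)
    (hf0 : f 0 = 0) {N : ContinuousMultilinearMap ℂ (fun _ : Fin d => E) (E →L[ℂ] F)}
    (hN : (fun z => _root_.fderiv ℂ f z - N fun _ => z) =O[𝓝 0] fun z => ‖z‖ ^ k) :
    (fun z => f z - ((d : ℂ) + 1)⁻¹ • N (fun _ => z) z) =O[𝓝 0] fun z => ‖z‖ ^ (k + 1) := by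
  obtain ⟨C, hC, hb⟩ := hN.exists_pos
  obtain ⟨R, hR, h⟩ := eventually_nhds_iff_ball.1 (hf.and hb.bound)
  refine IsBigO.of_bound C ?_
  filter_upwards [ball_mem_nhds (0 : E) hR] with z hz
  have hle : ∀ t ∈ closedBall (0 : ℂ) 1, ‖t • z‖ ≤ ‖z‖ := fun t ht => by
    rw [norm_smul]
    exact mul_le_of_le_one_left (norm_nonneg _) (mem_closedBall_zero_iff.1 ht)
  have hmem : ∀ t ∈ closedBall (0 : ℂ) 1, t • z ∈ ball (0 : E) R := fun t ht =>
    mem_ball_zero_iff.2 ((hle t ht).trans_lt (mem_ball_zero_iff.1 hz))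
  have key := (convex_closedBall (0 : ℂ) 1).norm_image_sub_le_of_norm_hasDerivWithin_le
    (C := C * ‖z‖ ^ (k + 1)) (x := 0) (y := 1)
    (fun t ht => (hasDerivAt_smul_sub_pow_smul N (h _ (hmem t ht)).1).hasDerivWithinAt)
    (fun t ht => ?_) (by simp) (by simp)
  · simpa [hf0] using key
  · calc ‖(_root_.fderiv ℂ f (t • z) - N fun _ => t • z) z‖
        ≤ ‖_root_.fderiv ℂ f (t • z) - N fun _ => t • z‖ * ‖z‖ := ContinuousLinearMap.le_opNorm _ _
      _ ≤ C * ‖t • z‖ ^ k * ‖z‖ := by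
          gcongr
          simpa using (h _ (hmem t ht)).2
      _ ≤ C * ‖z‖ ^ k * ‖z‖ := by
          gcongr
          exact hle t ht
      _ = C * ‖z‖ ^ (k + 1) := by ring

theorem HolomorphicAt.exists_multilinear_isBigO [FiniteDimensional ℂ E] (d : ℕ) :
    ∀ {F : Type u} [NormedAddCommGroup F] [NormedSpace ℂ F] [CompleteSpace F] {f : E → F},
    HolomorphicAt f 0 → (f =O[𝓝 0] fun z => ‖z‖ ^ d) →
    ∃ M : ContinuousMultilinearMap ℂ (fun _ : Fin d => E) F,
      (fun z => f z - M fun _ => z) =O[𝓝 0] fun z => ‖z‖ ^ (d + 1) := by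
  induction d with
  | zero =>
    intro F _ _ _ f hf _
    refine ⟨ContinuousMultilinearMap.constOfIsEmpty ℂ _ (f 0), ?_⟩
    simpa using hf.differentiableAt.isBigO_sub.norm_right
  | succ d ih =>
    intro F _ _ _ f hf hd
    obtain ⟨N, hN⟩ := ih hf.fderiv (hf.isBigO_fderiv hd)
    have hf0 : f 0 = 0 := IsBigO.eq_zero_of_norm_pow (n := d + 1) (by simpa using hd) (by omega)
    exact ⟨((d : ℂ) + 1)⁻¹ • ContinuousMultilinearMap.uncurryRight (Ei := fun _ => E) N,
      hf.isBigO_sub_of_fderiv hf0 hN⟩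

end Taylor

section LinearPart

open Module.End

theorem isBigO_pow_of_spectralRadius_lt {A : Type*} [NormedRing A] [NormedAlgebra ℂ A]
    [CompleteSpace A] {a : A} {ρ : ℝ} (h : spectralRadius ℂ a < ENNReal.ofReal ρ) :
    (fun k : ℕ => a ^ k) =O[atTop] fun k : ℕ => ρ ^ k := by
  have hρ : 0 < ρ := ENNReal.ofReal_pos.1 (bot_le.trans_lt h)
  refine IsBigO.of_bound 1 ?_
  filter_upwards [(spectrum.pow_norm_pow_one_div_tendsto_nhds_spectralRadius a).eventually_lt_const
    h, eventually_gt_atTop 0] with k hk hk0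
  rw [ENNReal.ofReal_lt_ofReal_iff hρ] at hk
  have hpow := pow_le_pow_left₀ (by positivity) hk.le k
  rw [one_div, Real.rpow_inv_natCast_pow (norm_nonneg _) hk0.ne'] at hpow
  rwa [one_mul, Real.norm_of_nonneg (by positivity)]

theorem isInternal_maxGenEigenspace {K V : Type*} [Field K] [IsAlgClosed K] [AddCommGroup V]
    [Module K V] [FiniteDimensional K V] (f : Module.End K V) [DecidableEq f.Eigenvalues] :
    DirectSum.IsInternal fun μ : f.Eigenvalues => f.maxGenEigenspace (μ : K) := by
  rw [DirectSum.isInternal_submodule_iff_iSupIndep_and_iSup_eq_top]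
  refine ⟨f.independent_maxGenEigenspace.comp Subtype.val_injective, ?_⟩
  rw [eq_top_iff, ← f.iSup_maxGenEigenspace_eq_top]
  refine iSup_le fun μ => ?_
  by_cases hμ : f.HasEigenvalue μ
  · exact le_iSup (fun μ : f.Eigenvalues => f.maxGenEigenspace (μ : K)) ⟨μ, hμ⟩
  · have hbot : f.maxGenEigenspace μ = ⊥ := by
      by_contra h
      exact hμ (HasUnifEigenvalue.lt zero_lt_one (k := ⊤) h)
    exact hbot ▸ bot_le

variable {E : Type*} [NormedAddCommGroup E] [NormedSpace ℂ E]

theorem map_mem_maxGenEigenspace {L : E →L[ℂ] E} {μ : ℂ} {x : E}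
    (hx : x ∈ maxGenEigenspace L.toLinearMap μ) : L x ∈ maxGenEigenspace L.toLinearMap μ :=
  mapsTo_maxGenEigenspace_of_comm (Commute.refl L.toLinearMap) μ hx

variable [FiniteDimensional ℂ E]

theorem spectralRadius_le_of_eigenvalues {B : E →L[ℂ] E} {r : ℝ}
    (h : ∀ c : ℂ, c ≠ 0 → HasEigenvalue B.toLinearMap c → ‖c‖ ≤ r) :
    spectralRadius ℂ B ≤ ENNReal.ofReal r := by
  have : CompleteSpace E := FiniteDimensional.complete ℂ E
  have : ProperSpace E := FiniteDimensional.proper ℂ E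
  have hB : IsCompactOperator B := isCompactOperator_of_locallyCompactSpace_dom (T := B)
  refine iSup₂_le fun c hc => ?_
  rw [← enorm_eq_nnnorm, ← ofReal_norm]
  rcases eq_or_ne c 0 with rfl | h0
  · simp
  · exact ENNReal.ofReal_le_ofReal <|
      h c h0 ((hB.hasEigenvalue_or_mem_resolventSet h0).resolve_right hc)

theorem isBigO_pow_of_eigenvalues {B : E →L[ℂ] E} {r ρ : ℝ} (hρ : 0 < ρ) (hrρ : r < ρ)
    (h : ∀ c : ℂ, c ≠ 0 → HasEigenvalue B.toLinearMap c → ‖c‖ ≤ r) :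
    (fun k : ℕ => B ^ k) =O[atTop] fun k : ℕ => ρ ^ k :=
  have : CompleteSpace E := FiniteDimensional.complete ℂ E
  isBigO_pow_of_spectralRadius_lt <|
    (spectralRadius_le_of_eigenvalues h).trans_lt ((ENNReal.ofReal_lt_ofReal_iff hρ).2 hrρ)

theorem isBigO_pow_mul_of_eigenvalues {A p : E →L[ℂ] E} {r ρ : ℝ} (hρ : 0 < ρ) (hrρ : r < ρ)
    (hc : Commute A p) (hp : IsIdempotentElem p)
    (h : ∀ (c : ℂ) (x : E), c ≠ 0 → x ≠ 0 → p x = x → A x = c • x → ‖c‖ ≤ r) :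
    (fun k : ℕ => A ^ k * p) =O[atTop] fun k : ℕ => ρ ^ k := by
  have hpow : (fun k : ℕ => (A * p) ^ k) =O[atTop] fun k : ℕ => ρ ^ k := by
    refine isBigO_pow_of_eigenvalues hρ hrρ fun c hc0 hev => ?_
    obtain ⟨x, hx⟩ := hev.exists_hasEigenvector
    have hApx : A (p x) = c • x := hx.apply_eq_smul
    have hpx : p x = x := by
      have hpA : p (A (p x)) = A (p x) :=
        DFunLike.congr_fun
          (show p * (A * p) = A * p by rw [← mul_assoc, ← hc.eq, mul_assoc, hp.eq]) x
      rw [hApx, map_smul] at hpA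
      exact smul_right_injective E hc0 hpA
    exact h c x hc0 hx.2 hpx (by rw [← hApx, hpx])
  have hmul : ∀ k : ℕ, (A * p) ^ k * p = A ^ k * p := fun k => by
    rw [hc.mul_pow, mul_assoc, ← pow_succ, hp.pow_succ_eq]
  simpa only [hmul, mul_one] using hpow.mul (isBigO_const_const p (one_ne_zero (α := ℝ)) atTop)

variable (L : E →L[ℂ] E)

open Classical in
/-- The projection of `E` onto the generalized eigenspace of `μ` along the other generalized
eigenspaces of `L`; it extracts the components of a vector in `E = ⨁ E_μ`. -/
def spectralProjection (μ : Eigenvalues L.toLinearMap) : E →L[ℂ] E :=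
  let := (isInternal_maxGenEigenspace L.toLinearMap).chooseDecomposition
  LinearMap.toContinuousLinearMap <| (maxGenEigenspace L.toLinearMap (μ : ℂ)).subtype ∘ₗ
    DirectSum.component ℂ _ _ μ ∘ₗ
      (DirectSum.decomposeLinearEquiv
        fun μ : Eigenvalues L.toLinearMap => maxGenEigenspace L.toLinearMap (μ : ℂ)).toLinearMap

namespace spectralProjection

variable {L}
variable {μ : Eigenvalues L.toLinearMap} {x : E}

theorem apply_of_mem (hx : x ∈ maxGenEigenspace L.toLinearMap (μ : ℂ)) :
    spectralProjection L μ x = x := by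
  classical
  let := (isInternal_maxGenEigenspace L.toLinearMap).chooseDecomposition
  exact DirectSum.decompose_of_mem_same
    (fun μ : Eigenvalues L.toLinearMap => maxGenEigenspace L.toLinearMap (μ : ℂ)) hx

theorem apply_of_mem_ne {ν : Eigenvalues L.toLinearMap}
    (hx : x ∈ maxGenEigenspace L.toLinearMap (ν : ℂ)) (hν : ν ≠ μ) :
    spectralProjection L μ x = 0 := by
  classical
  let := (isInternal_maxGenEigenspace L.toLinearMap).chooseDecomposition
  exact DirectSum.decompose_of_mem_ne
    (fun μ : Eigenvalues L.toLinearMap => maxGenEigenspace L.toLinearMap (μ : ℂ)) hx hν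

variable (μ x)

theorem apply_mem : spectralProjection L μ x ∈ maxGenEigenspace L.toLinearMap (μ : ℂ) :=
  Subtype.coe_prop _

variable (L) in
theorem sum_apply : ∑ μ, spectralProjection L μ x = x := by
  classical
  let := (isInternal_maxGenEigenspace L.toLinearMap).chooseDecomposition
  refine Eq.trans (Finset.sum_subset (Finset.subset_univ _) fun μ _ hμ => ?_).symm <|
    DirectSum.sum_support_decompose
      (fun μ : Eigenvalues L.toLinearMap => maxGenEigenspace L.toLinearMap (μ : ℂ)) x
  have hzero : DirectSum.decompose
      (fun μ : Eigenvalues L.toLinearMap => maxGenEigenspace L.toLinearMap (μ : ℂ)) x μ = 0 := by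
    simpa using hμ
  exact congrArg Subtype.val hzero

theorem apply_sum {t : Eigenvalues L.toLinearMap → E}
    (ht : ∀ μ : Eigenvalues L.toLinearMap, t μ ∈ maxGenEigenspace L.toLinearMap (μ : ℂ)) :
    spectralProjection L μ (∑ ν, t ν) = t μ := by
  rw [map_sum, Finset.sum_eq_single μ (fun ν _ hν => apply_of_mem_ne (ht ν) hν) (by simp),
    apply_of_mem (ht μ)]

theorem isIdempotentElem : IsIdempotentElem (spectralProjection L μ) :=
  ContinuousLinearMap.ext fun x => apply_of_mem (apply_mem μ x)

theorem commute : Commute L (spectralProjection L μ) := by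
  refine ContinuousLinearMap.ext fun x => ?_
  change L (spectralProjection L μ x) = spectralProjection L μ (L x)
  conv_rhs => rw [← sum_apply L x, map_sum]
  exact (apply_sum μ fun ν => map_mem_maxGenEigenspace (apply_mem ν x)).symm

variable {μ x}

theorem eigenvalue_eq {c : ℂ} (hx : x ≠ 0) (hμx : spectralProjection L μ x = x)
    (hc : L x = c • x) : c = μ := by
  have hev : HasEigenvalue L.toLinearMap c :=
    hasEigenvalue_of_hasEigenvector (hasEigenvector_iff.2 ⟨mem_eigenspace_iff.2 hc, hx⟩)
  by_contra hne
  have hmem : x ∈ maxGenEigenspace L.toLinearMap c :=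
    eigenspace_le_maxGenEigenspace (mem_eigenspace_iff.2 hc)
  exact hx (hμx.symm.trans
    (apply_of_mem_ne (ν := ⟨c, hev⟩) hmem fun h => hne (congrArg Subtype.val h)))

theorem isBigO_pow_mul {ρ : ℝ} (hρ : ‖(μ : ℂ)‖ < ρ) :
    (fun k : ℕ => L ^ k * spectralProjection L μ) =O[atTop] fun k : ℕ => ρ ^ k :=
  isBigO_pow_mul_of_eigenvalues ((norm_nonneg _).trans_lt hρ) hρ (commute μ) (isIdempotentElem μ)
    fun _ _ _ hx hμx hc => (congrArg norm (eigenvalue_eq hx hμx hc)).le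

theorem isBigO_symm_pow_mul {L : E ≃L[ℂ] E} {μ : Eigenvalues (L : E →L[ℂ] E).toLinearMap} {ρ : ℝ}
    (hρ : ‖(μ : ℂ)‖⁻¹ < ρ) :
    (fun k : ℕ => (L.symm : E →L[ℂ] E) ^ k * spectralProjection (L : E →L[ℂ] E) μ) =O[atTop]
      fun k : ℕ => ρ ^ k := by
  have hcomm : Commute (L.symm : E →L[ℂ] E) (spectralProjection (L : E →L[ℂ] E) μ) := by
    refine ContinuousLinearMap.ext fun x => L.symm_apply_eq.2 ?_
    have hx := DFunLike.congr_fun (commute μ).eq (L.symm x)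
    change L (spectralProjection _ μ (L.symm x)) = spectralProjection _ μ (L (L.symm x)) at hx
    rw [L.apply_symm_apply] at hx
    exact hx.symm
  refine isBigO_pow_mul_of_eigenvalues ((by positivity : (0 : ℝ) ≤ ‖(μ : ℂ)‖⁻¹).trans_lt hρ) hρ
    hcomm (isIdempotentElem μ) fun c x hc0 hx hμx hc => ?_
  have hLx : (L : E →L[ℂ] E) x = c⁻¹ • x := by
    rw [eq_inv_smul_iff₀ hc0, ← map_smul, ← hc]
    exact L.apply_symm_apply x
  rw [← eigenvalue_eq hx hμx hLx, norm_inv, inv_inv]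

end spectralProjection

end LinearPart

section CohomologicalEquation

open Module.End

theorem exists_sub_apply_eq_of_summable {R V : Type*} [Ring R] [AddCommGroup V] [Module R V]
    [TopologicalSpace V] [IsTopologicalAddGroup V] [T2Space V] (S : V →L[R] V) {x : V}
    (h : Summable fun k : ℕ => (S ^ k) x) : ∃ y, y - S y = x := by
  refine ⟨∑' k, (S ^ k) x, ?_⟩
  rw [S.map_tsum h]
  conv_lhs => rw [h.tsum_eq_zero_add]
  simp only [pow_zero, one_apply_eq_self, pow_succ', mul_apply_eq_comp]
  exact add_sub_cancel_right _ _

variable {E : Type*} [NormedAddCommGroup E] [NormedSpace ℂ E]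

/-- The operator `M ↦ L⁻¹ ∘ M ∘ (L, …, L)` on multilinear maps, the action of the linear change of
variables `L` on homogeneous vector fields. -/
def multilinearPullback (L : E ≃L[ℂ] E) (d : ℕ) :
    ContinuousMultilinearMap ℂ (fun _ : Fin d => E) E →L[ℂ]
      ContinuousMultilinearMap ℂ (fun _ : Fin d => E) E :=
  ContinuousLinearMap.compContinuousMultilinearMapL ℂ (fun _ : Fin d => E) E E (L.symm : E →L[ℂ] E)
    ∘L ContinuousMultilinearMap.compContinuousLinearMapL fun _ => (L : E →L[ℂ] E)

theorem multilinearPullback_pow_apply (L : E ≃L[ℂ] E) {d : ℕ}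
    (M : ContinuousMultilinearMap ℂ (fun _ : Fin d => E) E) (k : ℕ) :
    (multilinearPullback L d ^ k) M =
      ((L.symm : E →L[ℂ] E) ^ k).compContinuousMultilinearMap
        (M.compContinuousLinearMap fun _ => (L : E →L[ℂ] E) ^ k) := by
  induction k with
  | zero => rfl
  | succ k ih =>
    rw [pow_succ', mul_apply_eq_comp, ih]
    ext m
    change L.symm (((L.symm : E →L[ℂ] E) ^ k) (M fun j => ((L : E →L[ℂ] E) ^ k) (L (m j)))) = _
    rw [ContinuousLinearMap.compContinuousMultilinearMap_coe, Function.comp_apply, pow_succ',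
      pow_succ]
    rfl

theorem eigenvalue_ne_zero (L : E ≃L[ℂ] E) (μ : Eigenvalues (L : E →L[ℂ] E).toLinearMap) :
    (μ : ℂ) ≠ 0 := by
  intro h0
  obtain ⟨x, hx⟩ := HasUnifEigenvalue.exists_hasUnifEigenvector μ.2
  have hLx : L x = (μ : ℂ) • x := HasEigenvector.apply_eq_smul hx
  rw [h0, zero_smul] at hLx
  exact hx.2 (L.map_eq_zero_iff.1 hLx)

variable [FiniteDimensional ℂ E]

/-- The component of the multilinear map `M` which reads its `j`-th argument in the generalized
eigenspace of `ν j` and takes values in that of `μ`. -/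
def spectralBlock (L : E →L[ℂ] E) {d : ℕ} (M : ContinuousMultilinearMap ℂ (fun _ : Fin d => E) E)
    (μ : Eigenvalues L.toLinearMap) (ν : Fin d → Eigenvalues L.toLinearMap) :
    ContinuousMultilinearMap ℂ (fun _ : Fin d => E) E :=
  (spectralProjection L μ).compContinuousMultilinearMap
    (M.compContinuousLinearMap fun j => spectralProjection L (ν j))

theorem sum_spectralBlock (L : E →L[ℂ] E) {d : ℕ}
    (M : ContinuousMultilinearMap ℂ (fun _ : Fin d => E) E) :
    ∑ μ, ∑ ν, spectralBlock L M μ ν = M := by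
  classical
  ext m
  have hM := M.map_sum fun j ν => spectralProjection L ν (m j)
  simp only [spectralProjection.sum_apply] at hM
  rw [Finset.sum_comm]
  simp only [sum_apply]
  refine Eq.trans (Finset.sum_congr rfl fun ν _ => ?_) hM.symm
  exact spectralProjection.sum_apply L _

theorem isBigO_multilinearPullback_pow_spectralBlock {L : E ≃L[ℂ] E} {d : ℕ}
    (M : ContinuousMultilinearMap ℂ (fun _ : Fin d => E) E)
    {μ : Eigenvalues (L : E →L[ℂ] E).toLinearMap}
    {ν : Fin d → Eigenvalues (L : E →L[ℂ] E).toLinearMap} {ρ : ℝ} {σ : Fin d → ℝ}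
    (hρ : ‖(μ : ℂ)‖⁻¹ < ρ) (hσ : ∀ j, ‖(ν j : ℂ)‖ < σ j) :
    (fun k => (multilinearPullback L d ^ k) (spectralBlock (L : E →L[ℂ] E) M μ ν)) =O[atTop]
      fun k => (ρ * ∏ j, σ j) ^ k := by
  let π := spectralProjection (L : E →L[ℂ] E)
  have hnorm : ∀ k, ‖(multilinearPullback L d ^ k) (spectralBlock (L : E →L[ℂ] E) M μ ν)‖ ≤
      ‖(L.symm : E →L[ℂ] E) ^ k * π μ‖ * (∏ j, ‖(L : E →L[ℂ] E) ^ k * π (ν j)‖) * ‖M‖ := fun k => by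
    have hblock : (multilinearPullback L d ^ k) (spectralBlock (L : E →L[ℂ] E) M μ ν) =
        ((L.symm : E →L[ℂ] E) ^ k * π μ).compContinuousMultilinearMap
          (M.compContinuousLinearMap fun j => (L : E →L[ℂ] E) ^ k * π (ν j)) := by
      rw [multilinearPullback_pow_apply]
      simp only [π, ((spectralProjection.commute (L := (L : E →L[ℂ] E)) _).pow_left k).eq]
      rfl
    rw [hblock, mul_assoc, mul_comm _ ‖M‖]
    exact (ContinuousLinearMap.norm_compContinuousMultilinearMap_le _ _).trans
      (mul_le_mul_of_nonneg_left (M.norm_compContinuousLinearMap_le _) (norm_nonneg _))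
  have hprod : (fun k => ‖(L.symm : E →L[ℂ] E) ^ k * π μ‖ *
      (∏ j, ‖(L : E →L[ℂ] E) ^ k * π (ν j)‖) * ‖M‖) =O[atTop] fun k => ρ ^ k * (∏ j, σ j ^ k) * 1 :=
    ((spectralProjection.isBigO_symm_pow_mul hρ).norm_left.mul
      (IsBigO.finsetProd fun j _ => (spectralProjection.isBigO_pow_mul (hσ j)).norm_left)).mul
        (isBigO_const_const _ one_ne_zero _)
  simp only [mul_one, Finset.prod_pow, ← mul_pow] at hprod
  exact (isBigO_of_le _ fun k => (hnorm k).trans (le_abs_self _)).trans hprod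

theorem exists_sub_multilinearPullback_eq_spectralBlock {L : E ≃L[ℂ] E} {d : ℕ}
    (M : ContinuousMultilinearMap ℂ (fun _ : Fin d => E) E)
    {μ : Eigenvalues (L : E →L[ℂ] E).toLinearMap}
    {ν : Fin d → Eigenvalues (L : E →L[ℂ] E).toLinearMap}
    (hlt : ∏ j, ‖(ν j : ℂ)‖ < ‖(μ : ℂ)‖) :
    ∃ H : ContinuousMultilinearMap ℂ (fun _ : Fin d => E) E,
      H - multilinearPullback L d H = spectralBlock (L : E →L[ℂ] E) M μ ν := by
  have : CompleteSpace E := FiniteDimensional.complete ℂ E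
  have hpos (κ : Eigenvalues (L : E →L[ℂ] E).toLinearMap) : 0 < ‖(κ : ℂ)‖ :=
    norm_pos_iff.2 (eigenvalue_ne_zero L κ)
  obtain ⟨θ, hθ, hθ1⟩ : ∃ θ : ℝ, θ * ‖(μ : ℂ)‖⁻¹ * ∏ j, (θ * ‖(ν j : ℂ)‖) < 1 ∧ 1 < θ := by
    have hc : ContinuousAt (fun θ : ℝ => θ * ‖(μ : ℂ)‖⁻¹ * ∏ j, (θ * ‖(ν j : ℂ)‖)) 1 := by
      fun_prop
    have hev := hc.eventually_lt (continuousAt_const (y := (1 : ℝ))) (by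
      simpa only [one_mul, inv_mul_lt_iff₀ (hpos μ), mul_one] using hlt)
    exact ((hev.filter_mono nhdsWithin_le_nhds).and (self_mem_nhdsWithin (s := Ioi 1))).exists
  refine exists_sub_apply_eq_of_summable _ (summable_of_isBigO_nat
    (summable_geometric_of_lt_one (by positivity) hθ)
    (isBigO_multilinearPullback_pow_spectralBlock M ?_ fun j => ?_))
  · exact lt_mul_of_one_lt_left (inv_pos.2 (hpos μ)) hθ1
  · exact lt_mul_of_one_lt_left (hpos _) hθ1

open Classical in
/-- The sum of the blocks of `M` which are sub-resonant, the relation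
`log ‖μ‖ ≤ ∑ j, log ‖ν j‖` being written multiplicatively. -/
def subResonantPart (L : E →L[ℂ] E) {d : ℕ}
    (M : ContinuousMultilinearMap ℂ (fun _ : Fin d => E) E) :
    ContinuousMultilinearMap ℂ (fun _ : Fin d => E) E :=
  ∑ μ : Eigenvalues L.toLinearMap, ∑ ν : Fin d → Eigenvalues L.toLinearMap
    with ‖(μ : ℂ)‖ ≤ ∏ j, ‖(ν j : ℂ)‖, spectralBlock L M μ ν

theorem exists_sub_multilinearPullback_eq (L : E ≃L[ℂ] E) {d : ℕ}
    (M : ContinuousMultilinearMap ℂ (fun _ : Fin d => E) E) :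
    ∃ H : ContinuousMultilinearMap ℂ (fun _ : Fin d => E) E,
      H - multilinearPullback L d H = M - subResonantPart (L : E →L[ℂ] E) M := by
  classical
  suffices h : M - subResonantPart (L : E →L[ℂ] E) M ∈
      (1 - multilinearPullback L d).toLinearMap.range from h
  nth_rewrite 1 [← sum_spectralBlock (L : E →L[ℂ] E) M]
  rw [subResonantPart, ← Finset.sum_sub_distrib]
  refine Submodule.sum_mem _ fun μ _ => ?_
  rw [← Finset.sum_filter_add_sum_filter_not Finset.univ fun ν =>
    ‖(μ : ℂ)‖ ≤ ∏ j, ‖(ν j : ℂ)‖, add_sub_cancel_left]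
  exact Submodule.sum_mem _ fun ν hν =>
    exists_sub_multilinearPullback_eq_spectralBlock M (not_le.1 (Finset.mem_filter.1 hν).2)

theorem exists_cohomological (L : E ≃L[ℂ] E) {d : ℕ}
    (M : ContinuousMultilinearMap ℂ (fun _ : Fin d => E) E) :
    ∃ H : ContinuousMultilinearMap ℂ (fun _ : Fin d => E) E, ∀ z,
      L (H fun _ => z) - H (fun _ => L z) =
        M (fun _ => z) - subResonantPart (L : E →L[ℂ] E) M fun _ => z := by
  obtain ⟨H, hH⟩ := exists_sub_multilinearPullback_eq L M
  refine ⟨(L.symm : E →L[ℂ] E).compContinuousMultilinearMap H, fun z => ?_⟩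
  change L (L.symm (H fun _ => z)) - multilinearPullback L d H (fun _ => z) = _
  rw [L.apply_symm_apply]
  exact congrArg (fun T : ContinuousMultilinearMap ℂ (fun _ : Fin d => E) E => T fun _ => z) hH

end CohomologicalEquation

section SubResonantMaps

open Module.End

variable {n : ℕ}

theorem isHomogeneousPolynomialMap_multilinear {d : ℕ}
    (M : ContinuousMultilinearMap ℂ (fun _ : Fin d => (Fin n → ℂ)) (Fin n → ℂ)) :
    IsHomogeneousPolynomialMap d fun z => M fun _ => z := by
  classical
  refine ⟨fun i => ∑ f : Fin d → Fin n, MvPolynomial.C (M (fun j => Pi.single (f j) 1) i) *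
    ∏ j, MvPolynomial.X (f j), fun i => ?_, fun z i => ?_⟩
  · refine MvPolynomial.IsHomogeneous.sum _ _ _ fun f _ => ?_
    have hmon := (MvPolynomial.isHomogeneous_C (Fin n) (M (fun j => Pi.single (f j) 1) i)).mul
      (MvPolynomial.IsHomogeneous.prod Finset.univ (fun j : Fin d => MvPolynomial.X (f j))
        (fun _ => 1) fun j _ => MvPolynomial.isHomogeneous_X ℂ (f j))
    simpa using hmon
  · have hbasis : (M fun _ => z) = ∑ f : Fin d → Fin n,
        (∏ j, z (f j)) • M fun j => (Pi.single (f j) 1 : Fin n → ℂ) := by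
      conv_lhs => rw [pi_eq_sum_univ' z]
      exact (M.map_sum fun _ k => z k • (Pi.single k 1 : Fin n → ℂ)).trans <|
        Finset.sum_congr rfl fun f _ =>
          M.map_smul_univ (fun j => z (f j)) fun j => Pi.single (f j) 1
    simp [hbasis, Finset.sum_apply, mul_comm]

namespace IsHomogeneousPolynomialMap

variable {d : ℕ} {Q Q' : (Fin n → ℂ) → (Fin n → ℂ)}

theorem zero (d : ℕ) : IsHomogeneousPolynomialMap d (0 : (Fin n → ℂ) → (Fin n → ℂ)) :=
  ⟨0, fun _ => MvPolynomial.isHomogeneous_zero _ _ _, fun x i => by simp⟩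

theorem add (h : IsHomogeneousPolynomialMap d Q) (h' : IsHomogeneousPolynomialMap d Q') :
    IsHomogeneousPolynomialMap d (Q + Q') := by
  obtain ⟨q, hq, hQ⟩ := h
  obtain ⟨q', hq', hQ'⟩ := h'
  exact ⟨q + q', fun i => (hq i).add (hq' i), fun x i => by simp [hQ, hQ']⟩

theorem apply_smul (h : IsHomogeneousPolynomialMap d Q) (c : ℂ) (x : Fin n → ℂ) :
    Q (c • x) = c ^ d • Q x := by
  obtain ⟨q, hq, hQ⟩ := h
  ext i
  rw [hQ, Pi.smul_apply, hQ, smul_eq_mul, MvPolynomial.eval_eq, MvPolynomial.eval_eq,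
    Finset.mul_sum]
  refine Finset.sum_congr rfl fun m hm => ?_
  have hdeg : ∑ j ∈ m.support, m j = d :=
    ((hq i).degree_eq_sum_deg_support hm).symm
  simp only [Pi.smul_apply, smul_eq_mul, mul_pow, Finset.prod_mul_distrib,
    Finset.prod_pow_eq_pow_sum, hdeg]
  ring

end IsHomogeneousPolynomialMap

namespace IsPolynomialMap

variable {P P' : (Fin n → ℂ) → (Fin n → ℂ)}

theorem zero : IsPolynomialMap (0 : (Fin n → ℂ) → (Fin n → ℂ)) :=
  ⟨0, fun x i => by simp⟩

theorem add (h : IsPolynomialMap P) (h' : IsPolynomialMap P') : IsPolynomialMap (P + P') := by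
  obtain ⟨p, hp⟩ := h
  obtain ⟨p', hp'⟩ := h'
  exact ⟨p + p', fun x i => by simp [hp, hp']⟩

theorem differentiable (h : IsPolynomialMap P) : Differentiable ℂ P := by
  obtain ⟨p, hp⟩ := h
  refine differentiable_pi.2 fun i => ?_
  simp only [hp]
  induction p i using MvPolynomial.induction_on with
  | C a => simp
  | add p q hp hq => simpa using hp.fun_add hq
  | mul_X p j hp => simpa using hp.fun_mul (differentiable_apply j)

end IsPolynomialMap

variable {L : (Fin n → ℂ) →L[ℂ] (Fin n → ℂ)} {s : Eigenvalues L.toLinearMap → ℕ}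
  {μ : Eigenvalues L.toLinearMap}

namespace IsHomogeneousOfType

variable {Q Q' : (Fin n → ℂ) → (Fin n → ℂ)}

theorem zero (s : Eigenvalues L.toLinearMap → ℕ) : IsHomogeneousOfType L.toLinearMap s 0 :=
  ⟨⟨0, .zero 0⟩, rfl, by simp⟩

/- Scaling all components by `2` gives `2 ^ d • Q x = 2 ^ (∑ μ, s μ) • Q x`. -/
theorem isHomogeneousPolynomialMap (h : IsHomogeneousOfType L.toLinearMap s Q) :
    IsHomogeneousPolynomialMap (∑ μ, s μ) Q := by
  obtain ⟨d, hd⟩ := h.homogeneous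
  rcases eq_or_ne Q 0 with rfl | hQ
  · exact .zero _
  obtain ⟨x, hx⟩ := Function.ne_iff.1 hQ
  have hscale := h.scaling (fun _ => 2) (fun μ => spectralProjection L μ x)
    fun μ => spectralProjection.apply_mem μ x
  rw [← Finset.smul_sum, spectralProjection.sum_apply, hd.apply_smul, Finset.prod_pow_eq_pow_sum]
    at hscale
  have hpow : (2 : ℂ) ^ d = 2 ^ ∑ μ, s μ := smul_left_injective ℂ hx hscale
  have hdeg : d = ∑ μ, s μ := Nat.pow_right_injective le_rfl (by exact_mod_cast hpow)
  exact hdeg ▸ hd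

theorem add (h : IsHomogeneousOfType L.toLinearMap s Q)
    (h' : IsHomogeneousOfType L.toLinearMap s Q') :
    IsHomogeneousOfType L.toLinearMap s (Q + Q') where
  homogeneous := ⟨_, h.isHomogeneousPolynomialMap.add h'.isHomogeneousPolynomialMap⟩
  map_zero := by simp [h.map_zero, h'.map_zero]
  scaling a t ht := by simp [h.scaling a t ht, h'.scaling a t ht]

end IsHomogeneousOfType

namespace IsSubResonantComponent

variable {R R' : (Fin n → ℂ) → (Fin n → ℂ)}

theorem of_type {Q : (Fin n → ℂ) → (Fin n → ℂ)} (hs : SubResonanceRelation L.toLinearMap μ s)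
    (hQ : IsHomogeneousOfType L.toLinearMap s Q)
    (hmem : ∀ x, Q x ∈ maxGenEigenspace L.toLinearMap (μ : ℂ)) :
    IsSubResonantComponent L.toLinearMap μ Q :=
  ⟨{s}, fun _ => Q, fun t ht => Finset.mem_singleton.1 ht ▸ ⟨hs, hQ, hmem⟩, by simp⟩

theorem zero (μ : Eigenvalues L.toLinearMap) : IsSubResonantComponent L.toLinearMap μ 0 :=
  ⟨∅, 0, by simp, by simp⟩

theorem add (h : IsSubResonantComponent L.toLinearMap μ R)
    (h' : IsSubResonantComponent L.toLinearMap μ R') :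
    IsSubResonantComponent L.toLinearMap μ (R + R') := by
  classical
  obtain ⟨T, Q, hQ, hR⟩ := h
  obtain ⟨T', Q', hQ', hR'⟩ := h'
  refine ⟨T ∪ T', fun s => (if s ∈ T then Q s else 0) + if s ∈ T' then Q' s else 0,
    fun s hs => ⟨?_, .add ?_ ?_, fun x => add_mem ?_ ?_⟩, fun x => ?_⟩
  · exact (Finset.mem_union.1 hs).elim (fun h => (hQ s h).1) fun h => (hQ' s h).1
  · split_ifs with h
    exacts [(hQ s h).2.1, .zero s]
  · split_ifs with h
    exacts [(hQ' s h).2.1, .zero s]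
  · split_ifs with h
    exacts [(hQ s h).2.2 x, zero_mem _]
  · split_ifs with h
    exacts [(hQ' s h).2.2 x, zero_mem _]
  · simp [hR, hR', Finset.sum_add_distrib, ite_apply, Finset.sum_ite_mem]

end IsSubResonantComponent

namespace IsSubResonant

variable {P P' : (Fin n → ℂ) → (Fin n → ℂ)}

theorem zero : IsSubResonant L.toLinearMap (0 : (Fin n → ℂ) → (Fin n → ℂ)) :=
  ⟨.zero, rfl, 0, fun μ => .zero μ, by simp⟩

theorem add (h : IsSubResonant L.toLinearMap P) (h' : IsSubResonant L.toLinearMap P') :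
    IsSubResonant L.toLinearMap (P + P') := by
  obtain ⟨hP, hP0, R, hR, hPR⟩ := h
  obtain ⟨hP', hP0', R', hR', hPR'⟩ := h'
  exact ⟨hP.add hP', by simp [hP0, hP0'], R + R', fun μ => (hR μ).add (hR' μ),
    fun x => by simp [hPR, hPR', Finset.sum_add_distrib]⟩

theorem sum {ι : Type*} {I : Finset ι} {P : ι → (Fin n → ℂ) → (Fin n → ℂ)}
    (h : ∀ i ∈ I, IsSubResonant L.toLinearMap (P i)) :
    IsSubResonant L.toLinearMap fun x => ∑ i ∈ I, P i x := by
  simpa only [Finset.sum_fn] using Finset.sum_induction P _ (fun _ _ => add) zero h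

theorem of_component (hpoly : IsPolynomialMap P) (h0 : P 0 = 0)
    (h : IsSubResonantComponent L.toLinearMap μ P) : IsSubResonant L.toLinearMap P := by
  classical
  refine ⟨hpoly, h0, Pi.single μ P, fun κ => ?_, fun x => ?_⟩
  · rcases eq_or_ne κ μ with rfl | hκ
    · rwa [Pi.single_eq_same]
    · rw [Pi.single_eq_of_ne hκ]
      exact .zero κ
  · rw [← Finset.sum_apply, Finset.sum_pi_single', if_pos (Finset.mem_univ μ)]

end IsSubResonant

/-- The type of the multilinear block reading its arguments in the generalized eigenspaces
`ν 0, …, ν (d - 1)`: the number of arguments in each of them. -/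
def blockType {ι : Type*} [DecidableEq ι] {d : ℕ} (ν : Fin d → ι) (κ : ι) : ℕ :=
  Finset.card {j | ν j = κ}

theorem isHomogeneousOfType_spectralBlock {d : ℕ} (hd : d ≠ 0)
    (M : ContinuousMultilinearMap ℂ (fun _ : Fin d => (Fin n → ℂ)) (Fin n → ℂ))
    (μ : Eigenvalues L.toLinearMap) (ν : Fin d → Eigenvalues L.toLinearMap)
    [DecidableEq (Eigenvalues L.toLinearMap)] :
    IsHomogeneousOfType L.toLinearMap (blockType ν)
      fun z => spectralBlock L M μ ν fun _ => z where
  homogeneous := ⟨d, isHomogeneousPolynomialMap_multilinear _⟩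
  map_zero := by
    have : NeZero d := ⟨hd⟩
    exact (spectralBlock L M μ ν).map_zero
  scaling a t ht := by
    change spectralProjection L μ (M fun j => spectralProjection L (ν j) _) =
      _ • spectralProjection L μ (M fun j => spectralProjection L (ν j) _)
    have hsmul (j : Fin d) : spectralProjection L (ν j) (∑ κ, a κ • t κ) = a (ν j) • t (ν j) :=
      spectralProjection.apply_sum (ν j) fun κ => Submodule.smul_mem _ _ (ht κ)
    have hprod : ∏ j, a (ν j) = ∏ κ, a κ ^ blockType ν κ := by
      rw [← Finset.prod_fiberwise' Finset.univ ν a]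
      simp only [Finset.prod_const, blockType]
    simp only [hsmul, spectralProjection.apply_sum _ ht]
    rw [M.map_smul_univ, map_smul, hprod]

theorem subResonanceRelation_blockType [DecidableEq (Eigenvalues L.toLinearMap)]
    (h0 : ∀ κ : Eigenvalues L.toLinearMap, (κ : ℂ) ≠ 0) {d : ℕ} {μ : Eigenvalues L.toLinearMap}
    {ν : Fin d → Eigenvalues L.toLinearMap} (hle : ‖(μ : ℂ)‖ ≤ ∏ j, ‖(ν j : ℂ)‖) :
    SubResonanceRelation L.toLinearMap μ (blockType ν) := by
  have hlog : ∑ j, Real.log ‖(ν j : ℂ)‖ = ∑ κ, (blockType ν κ : ℝ) * Real.log ‖(κ : ℂ)‖ := by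
    rw [← Finset.sum_fiberwise' Finset.univ ν fun κ => Real.log ‖(κ : ℂ)‖]
    simp only [Finset.sum_const, blockType, nsmul_eq_mul]
  rw [SubResonanceRelation, ← hlog, ← Real.log_prod fun j _ => norm_ne_zero_iff.2 (h0 _)]
  exact Real.log_le_log (norm_pos_iff.2 (h0 μ)) hle

theorem isSubResonant_spectralBlock (h0 : ∀ κ : Eigenvalues L.toLinearMap, (κ : ℂ) ≠ 0) {d : ℕ}
    (hd : d ≠ 0) (M : ContinuousMultilinearMap ℂ (fun _ : Fin d => (Fin n → ℂ)) (Fin n → ℂ))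
    {μ : Eigenvalues L.toLinearMap} {ν : Fin d → Eigenvalues L.toLinearMap}
    (hle : ‖(μ : ℂ)‖ ≤ ∏ j, ‖(ν j : ℂ)‖) :
    IsSubResonant L.toLinearMap fun z => spectralBlock L M μ ν fun _ => z := by
  classical
  have htype := isHomogeneousOfType_spectralBlock hd M μ ν
  have hpoly := (isHomogeneousPolynomialMap_multilinear (spectralBlock L M μ ν)).imp
    fun _ h => h.2
  exact .of_component hpoly htype.map_zero <|
    .of_type (subResonanceRelation_blockType h0 hle) htype
      fun _ => spectralProjection.apply_mem μ _

theorem isSubResonant_subResonantPart (h0 : ∀ κ : Eigenvalues L.toLinearMap, (κ : ℂ) ≠ 0) {d : ℕ}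
    (hd : d ≠ 0) (M : ContinuousMultilinearMap ℂ (fun _ : Fin d => (Fin n → ℂ)) (Fin n → ℂ)) :
    IsSubResonant L.toLinearMap fun z => subResonantPart L M fun _ => z := by
  simp only [subResonantPart, sum_apply]
  exact .sum fun μ _ => .sum fun ν hν =>
    isSubResonant_spectralBlock h0 hd M (Finset.mem_filter.1 hν).2

theorem isSubResonant_linear (h0 : ∀ κ : Eigenvalues L.toLinearMap, (κ : ℂ) ≠ 0) :
    IsSubResonant L.toLinearMap L := by
  let M := ContinuousMultilinearMap.ofSubsingleton ℂ (Fin n → ℂ) (Fin n → ℂ) (0 : Fin 1) L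
  have hblock (μ : Eigenvalues L.toLinearMap) (z : Fin n → ℂ) :
      spectralBlock L M μ (fun _ => μ) (fun _ => z) = spectralProjection L μ (L z) := by
    change spectralProjection L μ (L (spectralProjection L μ z)) = _
    have hcomm : L (spectralProjection L μ z) = spectralProjection L μ (L z) :=
      DFunLike.congr_fun (spectralProjection.commute μ).eq z
    rw [hcomm, spectralProjection.apply_of_mem (spectralProjection.apply_mem μ _)]
  have hL : (L : (Fin n → ℂ) → (Fin n → ℂ)) =
      fun z => ∑ μ, spectralBlock L M μ (fun _ => μ) fun _ => z := by
    simp only [hblock, spectralProjection.sum_apply]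
  rw [hL]
  exact .sum fun μ _ => isSubResonant_spectralBlock h0 one_ne_zero M (by simp)

end SubResonantMaps

section Jets

section NormedSpace

variable {E F X : Type*} [NormedAddCommGroup E] [NormedSpace ℂ E] [NormedAddCommGroup F]
  [NormedSpace ℂ F] [NormedAddCommGroup X]

theorem HolomorphicAt.isBigO_add_sub_sub [FiniteDimensional ℂ E] [CompleteSpace F] {G : E → F}
    {A : E →L[ℂ] F} (hG : HolomorphicAt G 0) (hA : HasFDerivAt G A 0) :
    (fun p : E × E => G (p.1 + p.2) - G p.1 - A p.2) =O[𝓝 0]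
      fun p => (‖p.1‖ + ‖p.2‖) * ‖p.2‖ := by
  let _ : NormedSpace ℝ E := NormedSpace.restrictScalars ℝ ℂ E
  have hderiv := hG.fderiv.differentiableAt.isBigO_sub
  simp only [hA.fderiv, sub_zero] at hderiv
  obtain ⟨C, hC, hbound⟩ := hderiv.exists_pos
  obtain ⟨R, hR, hball⟩ := Metric.eventually_nhds_iff_ball.1 (hG.and hbound.bound)
  have hsmall : ∀ᶠ p : E × E in 𝓝 0, ‖p.1‖ + ‖p.2‖ < R :=
    ContinuousAt.eventually_lt (by fun_prop) continuousAt_const (by simpa using hR)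
  refine .of_bound C ?_
  filter_upwards [hsmall] with p hp
  have hmem (z) (hz : z ∈ closedBall (0 : E) (‖p.1‖ + ‖p.2‖)) : z ∈ ball (0 : E) R :=
    closedBall_subset_ball hp hz
  have hmean := (convex_closedBall (0 : E) (‖p.1‖ + ‖p.2‖)).norm_image_sub_le_of_norm_fderiv_le'
    (𝕜 := ℂ) (f := G) (φ := A) (C := C * (‖p.1‖ + ‖p.2‖)) (x := p.1) (y := p.1 + p.2)
    (fun z hz => (hball z (hmem z hz)).1)
    (fun z hz => (hball z (hmem z hz)).2.trans <|
      mul_le_mul_of_nonneg_left (mem_closedBall_zero_iff.1 hz) hC.le)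
    (mem_closedBall_zero_iff.2 <| le_add_of_nonneg_right (norm_nonneg _))
    (mem_closedBall_zero_iff.2 <| norm_add_le _ _)
  rw [add_sub_cancel_left, mul_assoc] at hmean
  rwa [Real.norm_of_nonneg (by positivity)]

theorem HolomorphicAt.isBigO_comp_add_sub [FiniteDimensional ℂ E] [CompleteSpace F] {G : E → F}
    {A : E →L[ℂ] F} (hG : HolomorphicAt G 0) (hA : HasFDerivAt G A 0) {u w : X → E} {d : ℕ}
    (hd : d ≠ 0) (hu : u =O[𝓝 0] fun z => ‖z‖) (hw : w =O[𝓝 0] fun z => ‖z‖ ^ d) :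
    (fun z => G (u z + w z) - G (u z) - A (w z)) =O[𝓝 0] fun z => ‖z‖ ^ (d + 1) := by
  have hnorm : Tendsto (fun z : X => ‖z‖) (𝓝 0) (𝓝 0) := tendsto_norm_zero
  have hw' : w =O[𝓝 0] fun z => ‖z‖ := by
    refine hw.trans <| .of_bound 1 ?_
    filter_upwards [hnorm.eventually_lt_const one_pos] with z hz
    rw [norm_pow, norm_norm, one_mul]
    exact pow_le_of_le_one (norm_nonneg _) hz.le hd
  have hpair : Tendsto (fun z => (u z, w z)) (𝓝 0) (𝓝 0) :=
    (hu.trans_tendsto hnorm).prodMk_nhds (hw'.trans_tendsto hnorm)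
  refine ((hG.isBigO_add_sub_sub hA).comp_tendsto hpair).trans ?_
  simp only [pow_succ']
  exact (hu.norm_left.add hw'.norm_left).mul hw.norm_left

theorem HolomorphicAt.isBigO_sub_linear [FiniteDimensional ℂ E] [CompleteSpace F] {G : E → F}
    {A : E →L[ℂ] F} (hG : HolomorphicAt G 0) (hA : HasFDerivAt G A 0) (h0 : G 0 = 0) :
    (fun z => G z - A z) =O[𝓝 0] fun z => ‖z‖ ^ 2 := by
  have hid : (fun z : E => z) =O[𝓝 0] fun z => ‖z‖ ^ 1 := by
    simpa only [pow_one] using (isBigO_refl (fun z : E => z) (𝓝 0)).norm_right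
  simpa only [zero_add, h0, sub_zero] using
    hG.isBigO_comp_add_sub hA one_ne_zero (isBigO_zero _ _) hid

theorem isBigO_norm_of_hasFDerivAt {f : E → F} {A : E →L[ℂ] F} (hf : HasFDerivAt f A 0)
    (h0 : f 0 = 0) : f =O[𝓝 0] fun z => ‖z‖ := by
  simpa only [h0, sub_zero] using hf.isBigO_sub.norm_right

theorem differentiable_multilinear_apply {d : ℕ}
    (H : ContinuousMultilinearMap ℂ (fun _ : Fin d => E) F) :
    Differentiable ℂ fun z => H fun _ => z :=
  (H.contDiff (n := 1)).differentiable one_ne_zero |>.comp <|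
    differentiable_pi.2 fun _ => differentiable_id

theorem isBigO_multilinear_apply {d : ℕ}
    (H : ContinuousMultilinearMap ℂ (fun _ : Fin d => E) F) :
    (fun z => H fun _ => z) =O[𝓝 0] fun z => ‖z‖ ^ d :=
  .of_bound ‖H‖ <| .of_forall fun z => by simpa using H.le_opNorm fun _ => z

theorem hasFDerivAt_multilinear_apply {d : ℕ} (hd : 2 ≤ d)
    (H : ContinuousMultilinearMap ℂ (fun _ : Fin d => E) F) :
    HasFDerivAt (fun z => H fun _ => z) (0 : E →L[ℂ] F) 0 := by
  have hO : (fun z => H fun _ => z) =O[𝓝 0] fun z => ‖z - 0‖ ^ d := by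
    simpa only [sub_zero] using isBigO_multilinear_apply H
  exact hO.hasFDerivAt hd

theorem hasFDerivAt_add_multilinear_apply {f : E → F} {A : E →L[ℂ] F} {d : ℕ} (hd : 2 ≤ d)
    (hf : HasFDerivAt f A 0) (H : ContinuousMultilinearMap ℂ (fun _ : Fin d => E) F) :
    HasFDerivAt (fun z => f z + H fun _ => z) A 0 := by
  simpa only [add_zero] using hf.fun_add (hasFDerivAt_multilinear_apply hd H)

theorem isBigO_multilinear_apply_sub {d : ℕ} (hd : d ≠ 0)
    (H : ContinuousMultilinearMap ℂ (fun _ : Fin d => E) F) {u v : X → E}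
    (hu : u =O[𝓝 0] fun z => ‖z‖) (hv : v =O[𝓝 0] fun z => ‖z‖)
    (huv : (fun z => u z - v z) =O[𝓝 0] fun z => ‖z‖ ^ 2) :
    (fun z => (H fun _ => u z) - H fun _ => v z) =O[𝓝 0] fun z => ‖z‖ ^ (d + 1) := by
  have : NeZero d := ⟨hd⟩
  have hlip : (fun z => (H fun _ => u z) - H fun _ => v z) =O[𝓝 0]
      fun z => (‖u z‖ + ‖v z‖) ^ (d - 1) * ‖u z - v z‖ := by
    refine .of_bound (‖H‖ * d) <| .of_forall fun z => ?_
    have hsub : (fun _ : Fin d => u z) - (fun _ => v z) = fun _ => u z - v z := rfl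
    have hle := H.norm_image_sub_le (fun _ => u z) fun _ => v z
    rw [hsub, pi_norm_const, pi_norm_const, pi_norm_const, Fintype.card_fin] at hle
    rw [Real.norm_of_nonneg (by positivity), ← mul_assoc]
    refine hle.trans ?_
    gcongr
    exact max_le_add_of_nonneg (norm_nonneg _) (norm_nonneg _)
  have hexp : d + 1 = d - 1 + 2 := by omega
  rw [hexp]
  simpa only [pow_add] using
    hlip.trans <| ((hu.norm_left.add hv.norm_left).pow (d - 1)).mul huv.norm_left

/-- The germ `φ` at `0`, tangent to the identity, conjugates `F` to `P` up to terms of order `d`. -/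
structure IsJetConjugacy (F φ P : E → E) (d : ℕ) : Prop where
  holomorphicAt : HolomorphicAt φ 0
  map_zero : φ 0 = 0
  hasFDerivAt : HasFDerivAt φ (ContinuousLinearMap.id ℂ E) 0
  isBigO : (fun z => F (φ z) - φ (P z)) =O[𝓝 0] fun z => ‖z‖ ^ d

namespace IsJetConjugacy

variable {F φ P : E → E} {L : E →L[ℂ] E} {d : ℕ}

theorem holomorphicAt_sub (hF : HolomorphicAt F 0) (hP : HolomorphicAt P 0) (hP0 : P 0 = 0)
    (h : IsJetConjugacy F φ P d) :
    HolomorphicAt (fun z => F (φ z) - φ (P z)) 0 := by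
  have hFφ : HolomorphicAt F (φ 0) := by rwa [h.map_zero]
  have hφP : HolomorphicAt φ (P 0) := by rw [hP0]; exact h.holomorphicAt
  exact (hFφ.comp h.holomorphicAt).sub (hφP.comp hP)

theorem sub_add [FiniteDimensional ℂ E] (hF : HolomorphicAt F 0) (hFL : HasFDerivAt F L 0)
    (hP : HolomorphicAt P 0) (hP0 : P 0 = 0) (hPL : HasFDerivAt P L 0) (hd : 2 ≤ d)
    (h : IsJetConjugacy F φ P d) {H M S : ContinuousMultilinearMap ℂ (fun _ : Fin d => E) E}
    (hM : (fun z => F (φ z) - φ (P z) - M fun _ => z) =O[𝓝 0] fun z => ‖z‖ ^ (d + 1))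
    (hH : ∀ z, L (H fun _ => z) - H (fun _ => L z) = (M fun _ => z) - S fun _ => z) :
    IsJetConjugacy F (fun z => φ z - H fun _ => z) (fun z => P z + S fun _ => z) (d + 1) := by
  have hd0 : d ≠ 0 := by omega
  have : NeZero d := ⟨hd0⟩
  have : CompleteSpace E := FiniteDimensional.complete ℂ E
  have hzero (T : ContinuousMultilinearMap ℂ (fun _ : Fin d => E) E) : (T fun _ => 0) = 0 :=
    T.map_zero
  have hφO := isBigO_norm_of_hasFDerivAt h.hasFDerivAt h.map_zero
  have hPO := isBigO_norm_of_hasFDerivAt hPL hP0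
  have hP'0 : P 0 + (S fun _ => 0) = 0 := by rw [hP0, hzero, add_zero]
  have hP'L := hasFDerivAt_add_multilinear_apply hd hPL S
  have hP' : HolomorphicAt (fun z => P z + S fun _ => z) 0 := by
    filter_upwards [hP] with z hz using hz.fun_add (differentiable_multilinear_apply S z)
  refine ⟨?_, by rw [h.map_zero, hzero, sub_zero], ?_, ?_⟩
  · filter_upwards [h.holomorphicAt] with z hz
    exact hz.fun_sub (differentiable_multilinear_apply H z)
  · simpa only [sub_zero] using h.hasFDerivAt.fun_sub (hasFDerivAt_multilinear_apply hd H)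
  · have hF_expand := hF.isBigO_comp_add_sub hFL hd0 hφO (isBigO_multilinear_apply H).neg_left
    have hφ_expand :=
      h.holomorphicAt.isBigO_comp_add_sub h.hasFDerivAt hd0 hPO (isBigO_multilinear_apply S)
    have hH_expand := isBigO_multilinear_apply_sub hd0 H (isBigO_norm_of_hasFDerivAt hP'L hP'0)
      (L.isBigO_id _).norm_right (hP'.isBigO_sub_linear hP'L hP'0)
    refine (((hF_expand.sub hφ_expand).add hH_expand).add hM).congr_left fun z => ?_
    have hcoh : M (fun _ => z) = L (H fun _ => z) - H (fun _ => L z) + S fun _ => z :=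
      sub_eq_iff_eq_add.1 (hH z).symm
    simp only [hcoh, map_neg, ← sub_eq_add_neg, ContinuousLinearMap.id_apply]
    abel

end IsJetConjugacy

end NormedSpace

theorem exists_isJetConjugacy {n : ℕ} {L : (Fin n → ℂ) ≃L[ℂ] (Fin n → ℂ)}
    {F : (Fin n → ℂ) → (Fin n → ℂ)} {d : ℕ} (hF : HolomorphicAt F 0) (hF0 : F 0 = 0)
    (hFL : HasFDerivAt F (L : (Fin n → ℂ) →L[ℂ] (Fin n → ℂ)) 0) (hd : 2 ≤ d) :
    ∃ φ P : (Fin n → ℂ) → (Fin n → ℂ),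
      IsSubResonant (L : (Fin n → ℂ) →L[ℂ] (Fin n → ℂ)).toLinearMap P ∧
      HasFDerivAt P (L : (Fin n → ℂ) →L[ℂ] (Fin n → ℂ)) 0 ∧ IsJetConjugacy F φ P d := by
  have hne := eigenvalue_ne_zero L
  induction d, hd using Nat.le_induction with
  | base =>
    exact ⟨id, L, isSubResonant_linear hne, L.hasFDerivAt, .of_forall fun _ => differentiableAt_id,
      rfl, hasFDerivAt_id 0, hF.isBigO_sub_linear hFL hF0⟩
  | succ d hd ih =>
    obtain ⟨φ, P, hP, hPL, hφ⟩ := ih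
    have hPh : HolomorphicAt P 0 := .of_forall hP.1.differentiable
    obtain ⟨M, hM⟩ :=
      (hφ.holomorphicAt_sub hF hPh hP.2.1).exists_multilinear_isBigO d hφ.isBigO
    obtain ⟨H, hH⟩ := exists_cohomological L M
    exact ⟨_, _, hP.add (isSubResonant_subResonantPart hne (by omega) M),
      hasFDerivAt_add_multilinear_apply hd hPL _, hφ.sub_add hF hFL hPh hP.2.1 hPL hd hM hH⟩

end Jets

section LocalInverse

variable {E : Type*} [NormedAddCommGroup E] [NormedSpace ℂ E] [FiniteDimensional ℂ E]

theorem HolomorphicAt.exists_openPartialHomeomorph {f : E → E} {x : E} {A : E ≃L[ℂ] E}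
    (hf : HolomorphicAt f x) (hA : HasFDerivAt f (A : E →L[ℂ] E) x) :
    ∃ e : OpenPartialHomeomorph E E, (DifferentiableOn ℂ e e.source ∧
      DifferentiableOn ℂ e.symm e.target) ∧ x ∈ e.source ∧ e = f := by
  have : CompleteSpace E := FiniteDimensional.complete ℂ E
  have hinv : ∀ᶠ z in 𝓝 x, (_root_.fderiv ℂ f z).IsInvertible := by
    have hA_mem : {B : E →L[ℂ] E | B.IsInvertible} ∈ 𝓝 (_root_.fderiv ℂ f x) := by
      rw [hA.fderiv]
      exact ContinuousLinearEquiv.nhds A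
    exact hf.fderiv.differentiableAt.continuousAt.eventually_mem hA_mem
  obtain ⟨V, hV, hVo, hxV⟩ := _root_.eventually_nhds_iff.1 (hf.and hinv)
  let e := (hf.contDiffAt_one.toOpenPartialHomeomorph f hA one_ne_zero).restrOpen V hVo
  have hmem (z) (hz : z ∈ e.source) : z ∈ V := hz.2
  refine ⟨e, ⟨fun z hz => (hV z (hmem z hz)).1.differentiableWithinAt, fun w hw => ?_⟩,
    ⟨hf.contDiffAt_one.mem_toOpenPartialHomeomorph_source hA one_ne_zero, hxV⟩, rfl⟩
  obtain ⟨hd, B, hB⟩ := hV _ (hmem _ (e.map_target hw))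
  have hderiv : HasFDerivAt e (B : E →L[ℂ] E) (e.symm w) := hB ▸ hd.hasFDerivAt
  exact (e.hasFDerivAt_symm hw hderiv).differentiableAt.differentiableWithinAt

/-- `G` is a holomorphic right inverse of `F` on the ball of radius `R` about `0`, Lipschitz with
constant `Λ`, and a left inverse of `F` near `0`. -/
structure IsLipschitzLocalInverse (F G : E → E) (Λ : NNReal) (R : ℝ) : Prop where
  radius_pos : 0 < R
  lipschitzOnWith : LipschitzOnWith Λ G (ball 0 R)
  differentiableOn : DifferentiableOn ℂ G (ball 0 R)
  apply_eq : ∀ y ∈ ball 0 R, F (G y) = y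
  eventually_apply_eq : ∀ᶠ z in 𝓝 0, G (F z) = z

theorem HolomorphicAt.exists_isLipschitzLocalInverse {F : E → E} {A : E ≃L[ℂ] E}
    (hF : HolomorphicAt F 0) (hF0 : F 0 = 0) (hA : HasFDerivAt F (A : E →L[ℂ] E) 0) :
    ∃ G Λ R, IsLipschitzLocalInverse F G Λ R := by
  have : CompleteSpace E := FiniteDimensional.complete ℂ E
  obtain ⟨e, ⟨-, hsymm⟩, h0, rfl⟩ := hF.exists_openPartialHomeomorph hA
  have ht : e.target ∈ 𝓝 0 := e.open_target.mem_nhds (hF0 ▸ e.map_source h0)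
  have hG : HolomorphicAt e.symm 0 :=
    (eventually_mem_nhds_iff.2 ht).mono fun y hy => hsymm.differentiableAt hy
  obtain ⟨Λ, s, hs, hΛ⟩ := hG.contDiffAt_one.exists_lipschitzOnWith
  obtain ⟨R, hR, hball⟩ := Metric.mem_nhds_iff.1 (inter_mem hs ht)
  exact ⟨e.symm, Λ, R, hR, hΛ.mono fun y hy => (hball hy).1, hsymm.mono fun y hy => (hball hy).2,
    fun y hy => e.right_inv (hball hy).2, e.eventually_left_inverse h0⟩

end LocalInverse

section AdaptedNorm

variable {E : Type*} [NormedAddCommGroup E] [NormedSpace ℂ E]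

/-- `N` is a norm adapted to `L`: it is equivalent to the ambient norm (with constant `D`) and `L`
multiplies it by at most `ρ`. -/
structure IsAdaptedNorm (L : E →L[ℂ] E) (N : Seminorm ℂ E) (D ρ : ℝ) : Prop where
  norm_le : ∀ z, ‖z‖ ≤ N z
  le_mul_norm : ∀ z, N z ≤ D * ‖z‖
  map_le : ∀ z, N (L z) ≤ ρ * N z

/-- The seminorm `∑ k < m, ρ⁻ᵏ ‖Lᵏ z‖`, which is adapted to `L` once `‖Lᵐ‖ ≤ ρᵐ`. -/
def orbitNorm (L : E →L[ℂ] E) (ρ : NNReal) (m : ℕ) : Seminorm ℂ E :=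
  .of (fun z => ∑ k ∈ Finset.range m, (ρ : ℝ)⁻¹ ^ k * ‖(L ^ k) z‖)
    (fun x y => by
      rw [← Finset.sum_add_distrib]
      refine Finset.sum_le_sum fun k _ => ?_
      rw [← mul_add, map_add]
      gcongr
      exact norm_add_le _ _)
    (fun c z => by simp only [map_smul, norm_smul, Finset.mul_sum, mul_left_comm])

theorem orbitNorm_apply (L : E →L[ℂ] E) (ρ : NNReal) (m : ℕ) (z : E) :
    orbitNorm L ρ m z = ∑ k ∈ Finset.range m, (ρ : ℝ)⁻¹ ^ k * ‖(L ^ k) z‖ :=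
  rfl

theorem isAdaptedNorm_orbitNorm {L : E →L[ℂ] E} {ρ : NNReal} {m : ℕ} (hρ : 0 < ρ) (hm : 0 < m)
    (hL : ‖L ^ m‖ ≤ ρ ^ m) :
    IsAdaptedNorm L (orbitNorm L ρ m) (∑ k ∈ Finset.range m, (ρ : ℝ)⁻¹ ^ k * ‖L ^ k‖) ρ where
  norm_le z := by
    have hle := Finset.single_le_sum (f := fun k => (ρ : ℝ)⁻¹ ^ k * ‖(L ^ k) z‖)
      (fun k _ => by positivity) (Finset.mem_range.2 hm)
    rw [orbitNorm_apply]
    simpa only [pow_zero, one_mul, one_apply_eq_self] using hle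
  le_mul_norm z := by
    rw [orbitNorm_apply, Finset.sum_mul]
    refine Finset.sum_le_sum fun k _ => ?_
    rw [mul_assoc]
    gcongr
    exact (L ^ k).le_opNorm z
  map_le z := by
    have hshift (k : ℕ) :
        (ρ : ℝ)⁻¹ ^ k * ‖(L ^ k) (L z)‖ = ρ * ((ρ : ℝ)⁻¹ ^ (k + 1) * ‖(L ^ (k + 1)) z‖) := by
      rw [pow_succ L, mul_apply_eq_comp, pow_succ]
      field_simp
    have hlast : (ρ : ℝ)⁻¹ ^ m * ‖(L ^ m) z‖ ≤ ‖z‖ := by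
      rw [inv_pow, inv_mul_le_iff₀ (by positivity)]
      exact (L ^ m).le_of_opNorm_le hL z
    have htelescope := Finset.sum_range_succ' (fun k => (ρ : ℝ)⁻¹ ^ k * ‖(L ^ k) z‖) m
    rw [Finset.sum_range_succ] at htelescope
    simp only [pow_zero, one_mul, one_apply_eq_self] at htelescope
    calc orbitNorm L ρ m (L z)
        = ρ * ∑ k ∈ Finset.range m, (ρ : ℝ)⁻¹ ^ (k + 1) * ‖(L ^ (k + 1)) z‖ := by
          rw [orbitNorm_apply, Finset.mul_sum]
          exact Finset.sum_congr rfl fun k _ => hshift k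
      _ ≤ ρ * ∑ k ∈ Finset.range m, (ρ : ℝ)⁻¹ ^ k * ‖(L ^ k) z‖ :=
          mul_le_mul_of_nonneg_left (by linarith) ρ.coe_nonneg

theorem exists_isAdaptedNorm {L : E →L[ℂ] E} {ρ₀ : ℝ} {ρ : NNReal} (hρ₀ : 0 < ρ₀) (hρ : ρ₀ < ρ)
    (hL : (fun k : ℕ => L ^ k) =O[atTop] fun k => ρ₀ ^ k) :
    ∃ N D, IsAdaptedNorm L N D ρ := by
  have hlittle : (fun k : ℕ => L ^ k) =o[atTop] fun k => (ρ : ℝ) ^ k :=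
    hL.trans_isLittleO <| isLittleO_pow_pow_of_lt_left hρ₀.le hρ
  obtain ⟨m, hm, hm0⟩ := ((hlittle.def one_pos).and (eventually_gt_atTop 0)).exists
  have hLm : ‖L ^ m‖ ≤ ρ ^ m := by simpa using hm
  exact ⟨_, _, isAdaptedNorm_orbitNorm (by exact_mod_cast hρ₀.trans hρ) hm0 hLm⟩

namespace IsAdaptedNorm

variable {L : E →L[ℂ] E} {N : Seminorm ℂ E} {D ρ ρ' : ℝ}

theorem continuous (h : IsAdaptedNorm L N D ρ) : Continuous N := by
  refine (LipschitzWith.of_le_add_mul D.toNNReal fun x y => ?_).continuous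
  calc N x = N (y + (x - y)) := by rw [add_sub_cancel]
    _ ≤ N y + N (x - y) := map_add_le_add N _ _
    _ ≤ N y + D.toNNReal * dist x y := by
      rw [dist_eq_norm]
      gcongr
      exact (h.le_mul_norm _).trans (by gcongr; exact D.le_coe_toNNReal)

theorem eventually_map_le (h : IsAdaptedNorm L N D ρ) {P : E → E} (hP : HasFDerivAt P L 0)
    (hP0 : P 0 = 0) (hρ : ρ < ρ') : ∀ᶠ z in 𝓝 0, N (P z) ≤ ρ' * N z := by
  have hsmall : (fun z => N (P z - L z)) =o[𝓝 0] fun z => z := by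
    have hO : (fun z => N (P z - L z)) =O[𝓝 0] fun z => P z - L z :=
      .of_bound D <| .of_forall fun z => by
        simpa only [Real.norm_of_nonneg (apply_nonneg N _)] using h.le_mul_norm _
    exact hO.trans_isLittleO <| by simpa only [hP0, sub_zero] using hP.isLittleO
  filter_upwards [hsmall.def (sub_pos.2 hρ)] with z hz
  rw [Real.norm_of_nonneg (apply_nonneg N _)] at hz
  calc N (P z) = N (L z + (P z - L z)) := by rw [add_sub_cancel]
    _ ≤ N (L z) + N (P z - L z) := map_add_le_add N _ _
    _ ≤ ρ * N z + (ρ' - ρ) * N z :=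
      add_le_add (h.map_le z) <| hz.trans <|
        mul_le_mul_of_nonneg_left (h.norm_le z) (sub_pos.2 hρ).le
    _ = ρ' * N z := by ring

end IsAdaptedNorm

theorem exists_forall_eigenvalue_norm_le [FiniteDimensional ℂ E] {L : Module.End ℂ E}
    (h : ∀ μ, L.HasEigenvalue μ → ‖μ‖ < 1) :
    ∃ r : NNReal, r < 1 ∧ ∀ μ, L.HasEigenvalue μ → ‖μ‖ ≤ r := by
  refine ⟨Finset.univ.sup fun μ : L.Eigenvalues => ‖(μ : ℂ)‖₊,
    (Finset.sup_lt_iff one_pos).2 fun μ _ => h μ μ.2, fun μ hμ => ?_⟩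
  exact_mod_cast
    Finset.le_sup (f := fun μ : L.Eigenvalues => ‖(μ : ℂ)‖₊) (Finset.mem_univ ⟨μ, hμ⟩)

theorem exists_isAdaptedNorm_of_eigenvalues [FiniteDimensional ℂ E] {L : E →L[ℂ] E}
    (h : ∀ μ, Module.End.HasEigenvalue L.toLinearMap μ → ‖μ‖ < 1) :
    ∃ N D, ∃ ρ < 1, 0 < ρ ∧ IsAdaptedNorm L N D ρ := by
  obtain ⟨r, hr, hle⟩ := exists_forall_eigenvalue_norm_le h
  obtain ⟨ρ₀, hrρ₀, hρ₀⟩ := exists_between hr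
  obtain ⟨ρ, hρ₀ρ, hρ⟩ := exists_between hρ₀
  have hρ₀pos : 0 < ρ₀ := pos_of_gt hrρ₀
  obtain ⟨N, D, hN⟩ := exists_isAdaptedNorm hρ₀pos hρ₀ρ <|
    isBigO_pow_of_eigenvalues hρ₀pos hrρ₀ fun μ _ hμ => hle μ hμ
  exact ⟨N, D, ρ, hρ, hρ₀pos.trans hρ₀ρ, hN⟩

end AdaptedNorm

section ExactConjugacy

/-- `φ` solves `ψ = G ∘ ψ ∘ P` on `B` up to an error `C * w`, where the weight `w` shrinks under `P`
fast enough (by `θ`) to beat the Lipschitz constant `Λ` of `G` on `s`. The last field leaves room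
in `s` for the total error of the successive approximations starting at `φ`. -/
structure IsApproximateSolution {X Y : Type*} [PseudoMetricSpace Y] (G : Y → Y) (P : X → X)
    (φ : X → Y) (B : Set X) (s : Set Y) (w : X → ℝ) (Λ : NNReal) (θ C : ℝ) : Prop where
  mapsTo : MapsTo P B B
  lipschitzOnWith : LipschitzOnWith Λ G s
  weight_le : ∀ z ∈ B, w (P z) ≤ θ * w z
  rate_nonneg : 0 ≤ θ
  rate_lt : Λ * θ < 1
  error_nonneg : 0 ≤ C
  dist_le : ∀ z ∈ B, dist (G (φ (P z))) (φ z) ≤ C * w z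
  closedBall_subset : ∀ z ∈ B, closedBall (φ z) (C / (1 - Λ * θ) * w z) ⊆ s

/-- The `k`-th successive approximation `G^k ∘ φ ∘ P^k` to a solution `ψ` of `ψ = G ∘ ψ ∘ P`. -/
def approximation {X Y : Type*} (G : Y → Y) (P : X → X) (φ : X → Y) (k : ℕ) (z : X) : Y :=
  G^[k] (φ (P^[k] z))

theorem approximation_succ {X Y : Type*} (G : Y → Y) (P : X → X) (φ : X → Y) (k : ℕ) (z : X) :
    approximation G P φ (k + 1) z = G (approximation G P φ k (P z)) := by
  rw [approximation, Function.iterate_succ_apply', Function.iterate_succ_apply, approximation]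

namespace IsApproximateSolution

variable {X Y : Type*} {G : Y → Y} {P : X → X} {φ : X → Y} {B : Set X} {s : Set Y} {w : X → ℝ}
  {Λ : NNReal} {θ C : ℝ} {z : X}

section PseudoMetricSpace

variable [PseudoMetricSpace Y]

theorem total_error_factor_nonneg (h : IsApproximateSolution G P φ B s w Λ θ C) :
    0 ≤ C / (1 - Λ * θ) :=
  div_nonneg h.error_nonneg (sub_pos.2 h.rate_lt).le

theorem total_error_nonneg (h : IsApproximateSolution G P φ B s w Λ θ C) (hz : z ∈ B) :
    0 ≤ C / (1 - Λ * θ) * w z := by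
  have hC : 0 ≤ C * w z := dist_nonneg.trans (h.dist_le z hz)
  rw [div_mul_eq_mul_div]
  exact div_nonneg hC (sub_pos.2 h.rate_lt).le

theorem dist_approximation_le (h : IsApproximateSolution G P φ B s w Λ θ C) (k : ℕ) (hz : z ∈ B) :
    dist (approximation G P φ k z) (φ z) ≤ C / (1 - Λ * θ) * w z := by
  induction k generalizing z with
  | zero => simpa only [approximation, Function.iterate_zero, id_eq, dist_self]
      using h.total_error_nonneg hz
  | succ k ih =>
    have hPz := h.mapsTo hz
    have hne : 1 - Λ * θ ≠ 0 := (sub_pos.2 h.rate_lt).ne'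
    rw [approximation_succ]
    calc dist (G (approximation G P φ k (P z))) (φ z)
        ≤ dist (G (approximation G P φ k (P z))) (G (φ (P z))) + dist (G (φ (P z))) (φ z) :=
          dist_triangle _ _ _
      _ ≤ Λ * (C / (1 - Λ * θ) * w (P z)) + C * w z := by
          refine add_le_add ((h.lipschitzOnWith.dist_le_mul _ ?_ _ ?_).trans ?_) (h.dist_le z hz)
          · exact h.closedBall_subset _ hPz (ih hPz)
          · exact h.closedBall_subset _ hPz (mem_closedBall_self (h.total_error_nonneg hPz))
          · exact mul_le_mul_of_nonneg_left (ih hPz) Λ.coe_nonneg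
      _ ≤ Λ * (C / (1 - Λ * θ) * (θ * w z)) + C * w z := by
          have := h.total_error_factor_nonneg
          gcongr
          exact h.weight_le z hz
      _ = C / (1 - Λ * θ) * w z := by field_simp; ring

theorem approximation_mem (h : IsApproximateSolution G P φ B s w Λ θ C) (k : ℕ) (hz : z ∈ B) :
    approximation G P φ k z ∈ s :=
  h.closedBall_subset z hz (h.dist_approximation_le k hz)

theorem dist_approximation_succ_le (h : IsApproximateSolution G P φ B s w Λ θ C) (k : ℕ)
    (hz : z ∈ B) :
    dist (approximation G P φ k z) (approximation G P φ (k + 1) z) ≤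
      C * w z * (Λ * θ) ^ k := by
  induction k generalizing z with
  | zero =>
    rw [dist_comm, pow_zero, mul_one]
    exact h.dist_le z hz
  | succ k ih =>
    have hPz := h.mapsTo hz
    rw [approximation_succ, approximation_succ _ _ _ (k + 1)]
    calc _ ≤ Λ * dist (approximation G P φ k (P z)) (approximation G P φ (k + 1) (P z)) :=
          h.lipschitzOnWith.dist_le_mul _ (h.approximation_mem k hPz) _
            (h.approximation_mem (k + 1) hPz)
      _ ≤ Λ * (C * w (P z) * (Λ * θ) ^ k) := by
          gcongr
          exact ih hPz
      _ ≤ Λ * (C * (θ * w z) * (Λ * θ) ^ k) := by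
          have := h.error_nonneg
          have := h.rate_nonneg
          gcongr
          exact h.weight_le z hz
      _ = C * w z * (Λ * θ) ^ (k + 1) := by ring

end PseudoMetricSpace

theorem exists_tendstoUniformlyOn [MetricSpace Y] [CompleteSpace Y] [Nonempty Y]
    (h : IsApproximateSolution G P φ B s w Λ θ C) {W : ℝ} (hW : ∀ z ∈ B, w z ≤ W) :
    ∃ ψ : X → Y, TendstoUniformlyOn (approximation G P φ) ψ atTop B := by
  have hlim : ∀ z ∈ B, ∃ y, Tendsto (fun k => approximation G P φ k z) atTop (𝓝 y) := fun z hz =>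
    cauchySeq_tendsto_of_complete <|
      cauchySeq_of_le_geometric _ _ h.rate_lt fun k => h.dist_approximation_succ_le k hz
  choose! ψ hψ using hlim
  refine ⟨ψ, Metric.tendstoUniformlyOn_iff.2 fun ε hε => ?_⟩
  have hgeom : Tendsto (fun k : ℕ => C * W * (Λ * θ) ^ k / (1 - Λ * θ)) atTop (𝓝 0) := by
    have hrate : 0 ≤ Λ * θ := mul_nonneg Λ.coe_nonneg h.rate_nonneg
    simpa only [mul_zero, zero_div] using
      ((tendsto_pow_atTop_nhds_zero_of_lt_one hrate h.rate_lt).const_mul (C * W)).div_const _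
  filter_upwards [hgeom.eventually_lt_const hε] with k hk z hz
  have hrate := sub_pos.2 h.rate_lt
  have := h.error_nonneg
  have := h.rate_nonneg
  rw [dist_comm]
  calc dist (approximation G P φ k z) (ψ z) ≤ C * w z * (Λ * θ) ^ k / (1 - Λ * θ) :=
        dist_le_of_le_geometric_of_tendsto _ _ h.rate_lt
          (fun k => h.dist_approximation_succ_le k hz) (hψ z hz) k
    _ ≤ C * W * (Λ * θ) ^ k / (1 - Λ * θ) := by gcongr; exact hW z hz
    _ < ε := hk

theorem dist_limit_le [PseudoMetricSpace Y] (h : IsApproximateSolution G P φ B s w Λ θ C)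
    {ψ : X → Y} (hψ : TendstoUniformlyOn (approximation G P φ) ψ atTop B) (hz : z ∈ B) :
    dist (ψ z) (φ z) ≤ C / (1 - Λ * θ) * w z :=
  le_of_tendsto ((hψ.tendsto_at hz).dist tendsto_const_nhds) <|
    .of_forall fun k => h.dist_approximation_le k hz

theorem limit_mem [PseudoMetricSpace Y] (h : IsApproximateSolution G P φ B s w Λ θ C)
    {ψ : X → Y} (hψ : TendstoUniformlyOn (approximation G P φ) ψ atTop B) (hz : z ∈ B) :
    ψ z ∈ s :=
  h.closedBall_subset z hz (h.dist_limit_le hψ hz)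

theorem limit_eq [MetricSpace Y] (h : IsApproximateSolution G P φ B s w Λ θ C)
    {ψ : X → Y} (hψ : TendstoUniformlyOn (approximation G P φ) ψ atTop B) (hz : z ∈ B) :
    ψ z = G (ψ (P z)) := by
  have hPz := h.mapsTo hz
  have hG : Tendsto (fun k => G (approximation G P φ k (P z))) atTop (𝓝 (G (ψ (P z)))) :=
    (h.lipschitzOnWith.continuousOn _ (h.limit_mem hψ hPz)).tendsto.comp <|
      tendsto_nhdsWithin_iff.2 ⟨hψ.tendsto_at hPz, .of_forall fun k => h.approximation_mem k hPz⟩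
  simp only [← approximation_succ] at hG
  exact tendsto_nhds_unique ((tendsto_add_atTop_iff_nat 1).2 (hψ.tendsto_at hz)) hG

theorem differentiableOn_approximation {E : Type*} [NormedAddCommGroup E] [NormedSpace ℂ E]
    {G P φ : E → E} {B s : Set E} {w : E → ℝ} (h : IsApproximateSolution G P φ B s w Λ θ C)
    (hG : DifferentiableOn ℂ G s) (hP : DifferentiableOn ℂ P B) (hφ : DifferentiableOn ℂ φ B)
    (k : ℕ) : DifferentiableOn ℂ (approximation G P φ k) B := by
  induction k with
  | zero => exact hφ
  | succ k ih =>
    exact (hG.comp (ih.comp hP h.mapsTo) fun z hz => h.approximation_mem k (h.mapsTo hz)).congr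
      fun z _ => approximation_succ G P φ k z

end IsApproximateSolution

theorem IsAdaptedNorm.eventually_forall_ball {E : Type*} [NormedAddCommGroup E] [NormedSpace ℂ E]
    {L : E →L[ℂ] E} {N : Seminorm ℂ E} {D ρ : ℝ} (h : IsAdaptedNorm L N D ρ) {p : E → Prop}
    (hp : ∀ᶠ z in 𝓝 0, p z) : ∀ᶠ r in 𝓝[>] 0, ∀ z ∈ N.ball 0 r, p z := by
  obtain ⟨ε, hε, hball⟩ := Metric.eventually_nhds_iff_ball.1 hp
  filter_upwards [Ioo_mem_nhdsGT hε] with r hr z hz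
  rw [Seminorm.mem_ball_zero] at hz
  exact hball z (mem_ball_zero_iff.2 ((h.norm_le z).trans_lt (hz.trans hr.2)))

variable {E : Type*} [NormedAddCommGroup E] [NormedSpace ℂ E] {F G φ P ψ : E → E} {L : E →L[ℂ] E}
  {N : Seminorm ℂ E} {D ρ R θ C : ℝ} {Λ : NNReal} {K : ℕ}

theorem IsJetConjugacy.eventually_dist_le (h : IsJetConjugacy F φ P K)
    (hF : ContinuousAt F 0) (hF0 : F 0 = 0) (hP : ContinuousAt P 0) (hP0 : P 0 = 0)
    (hG : IsLipschitzLocalInverse F G Λ R) :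
    ∃ C, 0 ≤ C ∧ ∀ᶠ z in 𝓝 0, dist (G (φ (P z))) (φ z) ≤ C * ‖z‖ ^ K := by
  obtain ⟨C, hC, hbound⟩ := h.isBigO.exists_nonneg
  have hφ : Tendsto φ (𝓝 0) (𝓝 0) :=
    h.hasFDerivAt.continuousAt.tendsto.trans_eq (by rw [h.map_zero])
  have hFφ : Tendsto (fun z => F (φ z)) (𝓝 0) (𝓝 0) :=
    Tendsto.comp (hF.tendsto.trans_eq (by rw [hF0])) hφ
  have hφP : Tendsto (fun z => φ (P z)) (𝓝 0) (𝓝 0) :=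
    hφ.comp (hP.tendsto.trans_eq (by rw [hP0]))
  have hball := ball_mem_nhds (0 : E) hG.radius_pos
  refine ⟨Λ * C, mul_nonneg Λ.coe_nonneg hC, ?_⟩
  filter_upwards [hbound.bound, hφ.eventually hG.eventually_apply_eq, hFφ.eventually_mem hball,
    hφP.eventually_mem hball] with z hz hGFz hFφz hφPz
  calc dist (G (φ (P z))) (φ z) = dist (G (φ (P z))) (G (F (φ z))) := by rw [hGFz]
    _ ≤ Λ * dist (φ (P z)) (F (φ z)) := hG.lipschitzOnWith.dist_le_mul _ hφPz _ hFφz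
    _ ≤ Λ * (C * ‖z‖ ^ K) := by
        rw [dist_comm, dist_eq_norm]
        rw [norm_pow, norm_norm] at hz
        gcongr
    _ = Λ * C * ‖z‖ ^ K := (mul_assoc _ _ _).symm

theorem IsJetConjugacy.eventually_isApproximateSolution (h : IsJetConjugacy F φ P K) (hK : K ≠ 0)
    (hF : ContinuousAt F 0) (hF0 : F 0 = 0) (hP : ContinuousAt P 0) (hP0 : P 0 = 0)
    (hG : IsLipschitzLocalInverse F G Λ R)
    (hN : IsAdaptedNorm L N D ρ) (hθ : 0 ≤ θ) (hθ1 : θ ≤ 1)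
    (hNP : ∀ᶠ z in 𝓝 0, N (P z) ≤ θ * N z) (hΛ : Λ * θ ^ K < 1) :
    ∃ C, ∀ᶠ r in 𝓝[>] 0, IsApproximateSolution G P φ (N.ball 0 r) (ball 0 R)
      (fun z => N z ^ K) Λ (θ ^ K) C := by
  obtain ⟨C, hC, hdist⟩ := h.eventually_dist_le hF hF0 hP hP0 hG
  have hsmall : ∀ᶠ z in 𝓝 0, ‖φ z‖ + C / (1 - Λ * θ ^ K) * N z ^ K < R := by
    have hcont : ContinuousAt (fun z => ‖φ z‖ + C / (1 - Λ * θ ^ K) * N z ^ K) 0 :=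
      h.hasFDerivAt.continuousAt.norm.add
        (continuousAt_const.mul (hN.continuous.continuousAt.pow K))
    refine hcont.eventually_lt continuousAt_const ?_
    simpa only [h.map_zero, norm_zero, _root_.map_zero N, zero_pow hK, mul_zero, add_zero] using
      hG.radius_pos
  refine ⟨C, ?_⟩
  filter_upwards [hN.eventually_forall_ball hNP, hN.eventually_forall_ball hdist,
    hN.eventually_forall_ball hsmall] with r hNPr hdistr hsmallr
  refine ⟨fun z hz => ?_, hG.lipschitzOnWith, fun z hz => ?_, pow_nonneg hθ K, hΛ,
    hC, fun z hz => ?_, fun z hz => ?_⟩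
  · rw [Seminorm.mem_ball_zero] at hz ⊢
    exact ((hNPr z (N.mem_ball_zero.2 hz)).trans
      (mul_le_of_le_one_left (apply_nonneg N z) hθ1)).trans_lt hz
  · rw [← mul_pow]
    exact pow_le_pow_left₀ (apply_nonneg N (P z)) (hNPr z hz) K
  · refine (hdistr z hz).trans ?_
    gcongr
    exact hN.norm_le z
  · refine closedBall_subset_ball' ?_
    rw [dist_zero_right, add_comm]
    exact hsmallr z hz

theorem IsApproximateSolution.isBigO_limit_sub {B s : Set E}
    (h : IsApproximateSolution G P φ B s (fun z => N z ^ K) Λ θ C) (hN : IsAdaptedNorm L N D ρ)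
    (hB : B ∈ 𝓝 0)
    (hψ : TendstoUniformlyOn (approximation G P φ) ψ atTop B) :
    (fun z => ψ z - φ z) =O[𝓝 0] fun z => ‖z‖ ^ K := by
  refine .of_bound (C / (1 - Λ * θ) * D ^ K) ?_
  filter_upwards [hB] with z hz
  have := h.total_error_factor_nonneg
  calc ‖ψ z - φ z‖ ≤ C / (1 - Λ * θ) * N z ^ K := by
        rw [← dist_eq_norm]
        exact h.dist_limit_le hψ hz
    _ ≤ C / (1 - Λ * θ) * (D * ‖z‖) ^ K := by
        gcongr
        exact hN.le_mul_norm z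
    _ = C / (1 - Λ * θ) * D ^ K * ‖‖z‖ ^ K‖ := by rw [norm_pow, norm_norm]; ring

/-- The germ `ψ` at `0`, tangent to the identity, conjugates `F` to `P`. -/
structure IsGermConjugacy (F ψ P : E → E) : Prop where
  holomorphicAt : HolomorphicAt ψ 0
  map_zero : ψ 0 = 0
  hasFDerivAt : HasFDerivAt ψ (ContinuousLinearMap.id ℂ E) 0
  eventually_eq : ∀ᶠ z in 𝓝 0, F (ψ z) = ψ (P z)

theorem IsJetConjugacy.exists_isGermConjugacy [FiniteDimensional ℂ E]
    (h : IsJetConjugacy F φ P K) (hK : 2 ≤ K)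
    (hF : ContinuousAt F 0) (hF0 : F 0 = 0) (hP : HolomorphicAt P 0) (hP0 : P 0 = 0)
    (hG : IsLipschitzLocalInverse F G Λ R) (hN : IsAdaptedNorm L N D ρ) (hθ : 0 ≤ θ) (hθ1 : θ ≤ 1)
    (hNP : ∀ᶠ z in 𝓝 0, N (P z) ≤ θ * N z) (hΛ : Λ * θ ^ K < 1) :
    ∃ ψ, IsGermConjugacy F ψ P := by
  have : CompleteSpace E := FiniteDimensional.complete ℂ E
  have hK0 : K ≠ 0 := by omega
  obtain ⟨C, hC⟩ := h.eventually_isApproximateSolution hK0 hF hF0 hP.differentiableAt.continuousAt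
    hP0 hG hN hθ hθ1 hNP hΛ
  obtain ⟨r, happrox, hφr, hPr, hr⟩ := (hC.and <| (hN.eventually_forall_ball h.holomorphicAt).and <|
    (hN.eventually_forall_ball hP).and self_mem_nhdsWithin).exists
  have hopen : IsOpen (N.ball 0 r) := by
    rw [Seminorm.ball_zero_eq]
    exact isOpen_lt hN.continuous continuous_const
  have hball : N.ball 0 r ∈ 𝓝 0 := hopen.mem_nhds (N.mem_ball_self hr)
  obtain ⟨ψ, hψ⟩ := happrox.exists_tendstoUniformlyOn (W := r ^ K) fun z hz =>
    pow_le_pow_left₀ (apply_nonneg N z) (N.mem_ball_zero.1 hz).le K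
  have hsub := happrox.isBigO_limit_sub hN hball hψ
  have hψ0 : ψ 0 = 0 := by
    have := happrox.dist_limit_le hψ (mem_of_mem_nhds hball)
    rw [_root_.map_zero, zero_pow hK0, mul_zero, h.map_zero] at this
    exact dist_le_zero.1 this
  refine ⟨ψ, ?_, hψ0, ?_, ?_⟩
  · have hdiff : DifferentiableOn ℂ ψ (N.ball 0 r) :=
      differentiableOn_of_tendstoUniformlyOn hopen (.of_forall <|
        happrox.differentiableOn_approximation hG.differentiableOn
          (fun z hz => (hPr z hz).differentiableWithinAt)
          fun z hz => (hφr z hz).differentiableWithinAt) hψ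
    filter_upwards [hball] with z hz using hdiff.differentiableAt (hopen.mem_nhds hz)
  · have hsub' : HasFDerivAt (fun z => ψ z - φ z) (0 : E →L[ℂ] E) 0 :=
      IsBigO.hasFDerivAt (by simpa only [sub_zero] using hsub) hK
    simpa only [sub_add_cancel, zero_add] using hsub'.fun_add h.hasFDerivAt
  · filter_upwards [hball] with z hz
    rw [happrox.limit_eq hψ hz]
    exact hG.apply_eq _ (happrox.limit_mem hψ (happrox.mapsTo hz))

theorem exists_isGermConjugacy {n : ℕ} {L : (Fin n → ℂ) ≃L[ℂ] (Fin n → ℂ)}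
    {F : (Fin n → ℂ) → (Fin n → ℂ)} (hF : HolomorphicAt F 0) (hF0 : F 0 = 0)
    (hFL : HasFDerivAt F (L : (Fin n → ℂ) →L[ℂ] (Fin n → ℂ)) 0)
    (hL : IsContracting (L : (Fin n → ℂ) →L[ℂ] (Fin n → ℂ)).toLinearMap) :
    ∃ ψ P, IsSubResonant (L : (Fin n → ℂ) →L[ℂ] (Fin n → ℂ)).toLinearMap P ∧
      HasFDerivAt P (L : (Fin n → ℂ) →L[ℂ] (Fin n → ℂ)) 0 ∧ IsGermConjugacy F ψ P := by
  obtain ⟨G, Λ, R, hG⟩ := hF.exists_isLipschitzLocalInverse hF0 hFL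
  obtain ⟨N, D, ρ, hρ, hρ0, hN⟩ := exists_isAdaptedNorm_of_eigenvalues hL
  obtain ⟨θ, hρθ, hθ⟩ := exists_between hρ
  have hθ0 : 0 ≤ (θ : ℝ) := (hρ0.trans hρθ).le
  have htendsto : Tendsto (fun K : ℕ => Λ * θ ^ K) atTop (𝓝 0) := by
    simpa only [mul_zero] using (tendsto_pow_atTop_nhds_zero_of_lt_one hθ0 hθ).const_mul (Λ : ℝ)
  obtain ⟨K, hΛ, hK⟩ :=
    ((htendsto.eventually_lt_const one_pos).and (eventually_ge_atTop 2)).exists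
  obtain ⟨φ, P, hP, hPL, hφ⟩ := exists_isJetConjugacy hF hF0 hFL hK
  have hP0 : P 0 = 0 := hP.2.1
  obtain ⟨ψ, hψ⟩ := hφ.exists_isGermConjugacy hK hF.differentiableAt.continuousAt hF0
    (.of_forall hP.1.differentiable) hP0 hG hN hθ0 hθ.le (hN.eventually_map_le hPL hP0 hρθ) hΛ
  exact ⟨ψ, P, hP, hPL, hψ⟩

end ExactConjugacy

end SubResonance

end

theorem theorem3p9 (n : ℕ) (U : Set (Fin n → ℂ)) (hU : IsOpen U) (h0U : (0 : Fin n → ℂ) ∈ U)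
    (F : (Fin n → ℂ) → (Fin n → ℂ)) (hF : DifferentiableOn ℂ F U) (hF0 : F 0 = 0)
    (L : (Fin n → ℂ) →L[ℂ] (Fin n → ℂ)) (hFL : HasFDerivAt F L 0)
    (hLinv : L.IsInvertible) (hLcontr : SubResonance.IsContracting L.toLinearMap) :
    ∃ P ∈ SubResonance.SRStar L.toLinearMap,
      HasFDerivAt P L 0 ∧
      ∃ φ : OpenPartialHomeomorph (Fin n → ℂ) (Fin n → ℂ),
        SubResonance.IsLocalBiholomorphism φ ∧
        (0 : Fin n → ℂ) ∈ φ.source ∧ φ 0 = 0 ∧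
        HasFDerivAt φ (ContinuousLinearMap.id ℂ (Fin n → ℂ)) 0 ∧
        ∀ᶠ z in 𝓝 (0 : Fin n → ℂ),
          z ∈ φ.source ∧ φ z ∈ U ∧ F (φ z) ∈ φ.target ∧ φ.symm (F (φ z)) = P z := by
  obtain ⟨e, rfl⟩ := hLinv
  have hF' : SubResonance.HolomorphicAt F 0 := by
    filter_upwards [hU.mem_nhds h0U] with z hz using hF.differentiableAt (hU.mem_nhds hz)
  obtain ⟨ψ, P, hP, hPL, hψ⟩ := SubResonance.exists_isGermConjugacy hF' hF0 hFL hLcontr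
  obtain ⟨φ, hφ, h0, rfl⟩ :=
    hψ.holomorphicAt.exists_openPartialHomeomorph (A := .refl ℂ _) hψ.hasFDerivAt
  refine ⟨P, ⟨hP, ?_⟩, hPL, φ, hφ, h0, hψ.map_zero, hψ.hasFDerivAt, ?_⟩
  · rw [hPL.fderiv]
    exact ⟨e, rfl⟩
  · have hsource := φ.open_source.mem_nhds h0
    have hP0 : Filter.Tendsto P (𝓝 0) (𝓝 0) :=
      hPL.continuousAt.tendsto.trans_eq (by rw [hP.2.1])
    have hφ0 : Filter.Tendsto φ (𝓝 0) (𝓝 0) :=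
      hψ.hasFDerivAt.continuousAt.tendsto.trans_eq (by rw [hψ.map_zero])
    filter_upwards [hsource, hP0.eventually_mem hsource, hφ0.eventually_mem (hU.mem_nhds h0U),
      hψ.eventually_eq] with z hz hPz hφz hconj
    rw [hconj]
    exact ⟨hz, hφz, φ.map_source hPz, φ.left_inv hPz⟩
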